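/- Throughout, $\log$ without a subscript denotes the logarithm to base $2$, and $\log^2 x=(\log x)^2$. For $0<\alpha<1$, a family of lines through the origin in $\mathbb{R}^r$ is called $\alpha$-equiangular if the acute angle between any two distinct lines of the family equals $\arccos\alpha$. Let $N_\alpha(r)$ denote the maximum number of $\alpha$-equiangular lines in $\mathbb{R}^r$. (1) Let $0<\alpha<1$ and let $r\ge 1/\alpha^4$ be an integer. Then every $\alpha$-equiangular family of lines in $\mathbb{R}^r$ is finite, and its number of lines is at most $$r+r\cdot\max\left\{\frac{66\log^2\left(\log_{1/\alpha} r\right)}{\log_{1/\alpha} r},\ 17\,\alpha\log\frac{2}{\alpha}\right\}.$$ (2) If $\alpha\to 0$ through positive values and the positive integers $r$ satisfy $r\ge(1/\alpha)^{\omega}$ for some exponents $\omega\to\infty$, then $N_\alpha(r)$ is finite from some point on and $$N_\alpha(r)=r+o(r).$$ -/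

import Mathlib

open scoped LinearAlgebra.Projectivization

/-- The acute angle (in `[0, π/2]`) between two lines through the origin, computed from
direction vectors; see `acuteAngle_mk` for independence of the chosen directions. -/
noncomputable def acuteAngle {V : Type*} [NormedAddCommGroup V] [InnerProductSpace ℝ V]
    (L M : ℙ ℝ V) : ℝ :=
  min (InnerProductGeometry.angle L.rep M.rep)
    (Real.pi - InnerProductGeometry.angle L.rep M.rep)

/-- The acute angle may be computed from arbitrary nonzero direction vectors. -/
theorem acuteAngle_mk {V : Type*} [NormedAddCommGroup V] [InnerProductSpace ℝ V]
    (u v : V) (hu : u ≠ 0) (hv : v ≠ 0) :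
    acuteAngle (Projectivization.mk ℝ u hu) (Projectivization.mk ℝ v hv) =
      min (InnerProductGeometry.angle u v) (Real.pi - InnerProductGeometry.angle u v) := by
  obtain ⟨a, ha⟩ := Projectivization.exists_smul_eq_mk_rep ℝ u hu
  obtain ⟨b, hb⟩ := Projectivization.exists_smul_eq_mk_rep ℝ v hv
  have hp : Real.pi - (Real.pi - InnerProductGeometry.angle u v) =
      InnerProductGeometry.angle u v := by ring
  unfold acuteAngle
  rw [← ha, ← hb, Units.smul_def, Units.smul_def]
  rcases lt_or_gt_of_ne a.ne_zero with h1 | h1 <;>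
    rcases lt_or_gt_of_ne b.ne_zero with h2 | h2 <;>
    simp [InnerProductGeometry.angle_smul_left_of_pos, InnerProductGeometry.angle_smul_right_of_pos,
      InnerProductGeometry.angle_smul_left_of_neg, InnerProductGeometry.angle_smul_right_of_neg,
      InnerProductGeometry.angle_neg_left, InnerProductGeometry.angle_neg_right, h1, h2, min_comm]

/-- A family of lines through the origin of `ℝ^r` is `α`-equiangular if the acute angle between
any two distinct lines of the family is `arccos α`. -/
def IsEquiangular (α : ℝ) {r : ℕ} (C : Set (ℙ ℝ (EuclideanSpace ℝ (Fin r)))) : Prop :=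
  ∀ L ∈ C, ∀ M ∈ C, L ≠ M → acuteAngle L M = Real.arccos α

/-- The maximum number of `α`-equiangular lines in `ℝ^r`, as an extended natural number. -/
noncomputable def maxEquiangular (α : ℝ) (r : ℕ) : ℕ∞ :=
  ⨆ (C : Set (ℙ ℝ (EuclideanSpace ℝ (Fin r)))) (_ : IsEquiangular α C), C.encard

/-- The rank-one matrix `x yᵀ`, as a vector of the Euclidean space of matrices. -/
noncomputable def tensorVec {r : ℕ} (x y : EuclideanSpace ℝ (Fin r)) :
    EuclideanSpace ℝ (Fin r × Fin r) :=
  WithLp.toLp 2 fun p => x p.1 * y p.2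

theorem inner_tensorVec {r : ℕ} (x y z w : EuclideanSpace ℝ (Fin r)) :
    inner ℝ (tensorVec x y) (tensorVec z w) = inner ℝ x z * inner ℝ y w := by
  simp only [tensorVec, PiLp.inner_apply, RCLike.inner_apply, conj_trivial,
    Fintype.sum_prod_type, Finset.sum_mul_sum]
  refine Finset.sum_congr rfl fun i _ => Finset.sum_congr rfl fun j _ => by ring

theorem sq_sum_mul_inner_le {ι : Type*} [Fintype ι] [DecidableEq ι] {r : ℕ} {α : ℝ}
    (v : ι → EuclideanSpace ℝ (Fin r)) (h1 : ∀ k, inner ℝ (v k) (v k) = 1)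
    (h2 : ∀ k l, k ≠ l → inner ℝ (v k) (v l) ^ 2 = α ^ 2) (c : ι → ℝ)
    (x y : EuclideanSpace ℝ (Fin r)) :
    (∑ k, c k * (inner ℝ x (v k) * inner ℝ y (v k))) ^ 2 ≤
      (inner ℝ x x * inner ℝ y y + inner ℝ x y ^ 2) / 2 *
        ((1 - α ^ 2) * ∑ k, c k ^ 2 + α ^ 2 * (∑ k, c k) ^ 2) := by
  have key := real_inner_mul_inner_self_le (tensorVec x y + tensorVec y x)
    (∑ k, c k • tensorVec (v k) (v k))
  have e1 : inner ℝ (tensorVec x y + tensorVec y x) (∑ k, c k • tensorVec (v k) (v k)) =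
      2 * ∑ k, c k * (inner ℝ x (v k) * inner ℝ y (v k)) := by
    simp only [inner_sum, inner_smul_right, inner_add_left, inner_tensorVec, Finset.mul_sum]
    exact Finset.sum_congr rfl fun k _ => by ring
  have e2 : inner ℝ (tensorVec x y + tensorVec y x) (tensorVec x y + tensorVec y x) =
      2 * (inner ℝ x x * inner ℝ y y + inner ℝ x y ^ 2) := by
    simp only [inner_add_left, inner_add_right, inner_tensorVec, real_inner_comm x y]
    ring
  have e3 : inner ℝ (∑ k, c k • tensorVec (v k) (v k)) (∑ k, c k • tensorVec (v k) (v k)) =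
      (1 - α ^ 2) * ∑ k, c k ^ 2 + α ^ 2 * (∑ k, c k) ^ 2 := by
    have : ∀ k l, inner ℝ (v k) (v l) * inner ℝ (v k) (v l) =
        α ^ 2 + (if k = l then 1 - α ^ 2 else 0) := by
      intro k l
      split_ifs with h
      · subst h; rw [h1]; ring
      · rw [← sq, h2 k l h]; ring
    simp only [sum_inner, inner_sum, inner_smul_right, inner_smul_left, inner_tensorVec, this,
      conj_trivial, mul_add, mul_ite, mul_zero, Finset.sum_add_distrib, Finset.sum_ite_eq',
      Finset.mem_univ, if_true]
    rw [sq (∑ k, c k), Finset.sum_mul_sum, Finset.mul_sum, Finset.mul_sum, add_comm]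
    congr 1
    · exact Finset.sum_congr rfl fun k _ => by ring
    · refine Finset.sum_congr rfl fun k _ => ?_
      rw [Finset.mul_sum, Finset.mul_sum]
      exact Finset.sum_congr rfl fun l _ => by ring
  rw [e1, e2, e3] at key
  nlinarith [key]

theorem sq_sum_inner_self_le {ι : Type*} [Fintype ι] {r : ℕ}
    (u : ι → EuclideanSpace ℝ (Fin r)) :
    (∑ k, inner ℝ (u k) (u k)) ^ 2 ≤ r * ∑ k, ∑ l, inner ℝ (u k) (u l) ^ 2 := by
  let I : EuclideanSpace ℝ (Fin r × Fin r) := WithLp.toLp 2 fun p => if p.1 = p.2 then 1 else 0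
  have key := real_inner_mul_inner_self_le I (∑ k, tensorVec (u k) (u k))
  have e1 : inner ℝ I (∑ k, tensorVec (u k) (u k)) = ∑ k, inner ℝ (u k) (u k) := by
    rw [inner_sum]
    refine Finset.sum_congr rfl fun k _ => ?_
    simp only [I, tensorVec, PiLp.inner_apply, Fintype.sum_prod_type, RCLike.inner_apply,
      conj_trivial]
    simp
  have e2 : inner ℝ I I = (r : ℝ) := by
    simp only [I, PiLp.inner_apply, Fintype.sum_prod_type, RCLike.inner_apply, conj_trivial]
    simp
  have e3 : inner ℝ (∑ k, tensorVec (u k) (u k)) (∑ k, tensorVec (u k) (u k)) =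
      ∑ k, ∑ l, inner ℝ (u k) (u l) ^ 2 := by
    simp only [sum_inner, inner_sum, inner_tensorVec, sq]
    exact Finset.sum_comm
  rw [e1, e2, e3] at key
  rw [sq]; exact key

/-- Unit vectors with pairwise inner products `±α`, the pairs with inner product `-α` being
recorded in the adjacency matrix `A`. -/
structure EquiangularGraph {ι : Type*} [DecidableEq ι] {r : ℕ} (α : ℝ)
    (v : ι → EuclideanSpace ℝ (Fin r)) (A : Matrix ι ι ℝ) : Prop where
  symm : ∀ i j, A i j = A j i
  entry : ∀ i j, A i j = 0 ∨ A i j = 1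
  diag : ∀ i, A i i = 0
  gram : ∀ i j, inner ℝ (v i) (v j) = (1 - α) * (if i = j then 1 else 0) + α - 2 * α * A i j

namespace EquiangularGraph

variable {ι : Type*} [DecidableEq ι] {r : ℕ} {α : ℝ}
  {v : ι → EuclideanSpace ℝ (Fin r)} {A : Matrix ι ι ℝ}

theorem nonneg (h : EquiangularGraph α v A) (i j : ι) : 0 ≤ A i j := by
  rcases h.entry i j with e | e <;> simp [e]

theorem sq_entry (h : EquiangularGraph α v A) (i j : ι) : A i j * A i j = A i j := by
  rcases h.entry i j with e | e <;> simp [e]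

theorem inner_self (h : EquiangularGraph α v A) (i : ι) : inner ℝ (v i) (v i) = 1 := by
  rw [h.gram]; simp [h.diag]

theorem inner_sq (h : EquiangularGraph α v A) (i j : ι) (hij : i ≠ j) :
    inner ℝ (v i) (v j) ^ 2 = α ^ 2 := by
  rw [h.gram, if_neg hij]
  rcases h.entry i j with e | e <;> rw [e] <;> ring

variable [Fintype ι]

theorem inner_sum_smul (h : EquiangularGraph α v A) (x : ι → ℝ) (i : ι) :
    inner ℝ (v i) (∑ j, x j • v j) =
      (1 - α) * x i + α * ∑ j, x j - 2 * α * ∑ j, A i j * x j := by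
  simp only [inner_sum, inner_smul_right, h.gram, mul_sub, mul_add, Finset.sum_sub_distrib,
    Finset.sum_add_distrib, mul_ite, mul_zero, Finset.sum_ite_eq, Finset.mem_univ, if_true,
    Finset.mul_sum]
  congr 1
  · congr 1
    · ring
    · exact Finset.sum_congr rfl fun j _ => by ring
  · exact Finset.sum_congr rfl fun j _ => by ring

theorem quadratic_le (h : EquiangularGraph α v A) (hα : 0 < α) (x : ι → ℝ) :
    ∑ i, ∑ j, x i * A i j * x j ≤
      (1 - α) / (2 * α) * ∑ i, x i ^ 2 + (∑ i, x i) ^ 2 / 2 := by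
  have key : (0 : ℝ) ≤ inner ℝ (∑ j, x j • v j) (∑ j, x j • v j) := real_inner_self_nonneg
  rw [sum_inner] at key
  simp only [inner_smul_left, h.inner_sum_smul, conj_trivial, mul_sub, mul_add,
    Finset.sum_sub_distrib, Finset.sum_add_distrib] at key
  have e1 : ∑ i, x i * ((1 - α) * x i) = (1 - α) * ∑ i, x i ^ 2 := by
    rw [Finset.mul_sum]; exact Finset.sum_congr rfl fun j _ => by ring
  have e2 : ∑ i, x i * (α * ∑ j, x j) = α * (∑ i, x i) ^ 2 := by
    rw [← Finset.sum_mul]; ring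
  have e3 : ∑ i, x i * (2 * α * ∑ j, A i j * x j) =
      2 * α * ∑ i, ∑ j, x i * A i j * x j := by
    rw [Finset.mul_sum]
    refine Finset.sum_congr rfl fun j _ => ?_
    rw [Finset.mul_sum, Finset.mul_sum, Finset.mul_sum]
    exact Finset.sum_congr rfl fun j _ => by ring
  rw [e1, e2, e3] at key
  have h2 : (1 - α) / (2 * α) * ∑ i, x i ^ 2 = ((1 - α) * ∑ i, x i ^ 2) / (2 * α) := by ring
  have h3 : (∑ i, x i) ^ 2 / 2 = α * (∑ i, x i) ^ 2 / (2 * α) := by field_simp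
  rw [h2, h3, ← add_div, le_div_iff₀ (by positivity)]
  linarith

/-- The quadratic form of `A` on centered vectors. -/
theorem quadratic_sub_const_le (h : EquiangularGraph α v A) (hα : 0 < α) [Nonempty ι]
    (x : ι → ℝ) (m : ℝ) (hm : ∑ i, x i = m * Fintype.card ι) :
    ∑ i, ∑ j, x i * A i j * x j - 2 * m * ∑ i, x i * ∑ j, A i j + m ^ 2 * ∑ i, ∑ j, A i j ≤
      (1 - α) / (2 * α) * (∑ i, x i ^ 2 - m ^ 2 * Fintype.card ι) := by
  have key := h.quadratic_le hα (fun i => x i - m)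
  have e0 : ∑ i, (x i - m) = 0 := by
    simp [Finset.sum_sub_distrib, hm]; ring
  have e1 : ∑ i, (x i - m) ^ 2 = ∑ i, x i ^ 2 - m ^ 2 * Fintype.card ι := by
    have : ∀ i, (x i - m) ^ 2 = x i ^ 2 - 2 * m * x i + m ^ 2 := fun i => by ring
    simp only [this, Finset.sum_add_distrib, Finset.sum_sub_distrib, ← Finset.mul_sum, hm]
    simp; ring
  have e3 : ∑ i, ∑ j, A i j * x j = ∑ i, x i * ∑ j, A i j := by
    rw [Finset.sum_comm]
    refine Finset.sum_congr rfl fun i _ => ?_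
    rw [Finset.mul_sum]
    exact Finset.sum_congr rfl fun j _ => by rw [h.symm i j]; ring
  have e2 : ∑ i, ∑ j, (x i - m) * A i j * (x j - m) =
      ∑ i, ∑ j, x i * A i j * x j - 2 * m * ∑ i, x i * ∑ j, A i j + m ^ 2 * ∑ i, ∑ j, A i j := by
    have : ∀ i j, (x i - m) * A i j * (x j - m) =
      x i * A i j * x j - m * (x i * A i j) - m * (A i j * x j) + m ^ 2 * A i j :=
      fun i j => by ring
    simp only [this, Finset.sum_add_distrib, Finset.sum_sub_distrib, ← Finset.mul_sum, e3]
    ring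
  rw [e0, e1, e2] at key
  simpa using key

end EquiangularGraph

namespace EquiangularGraph

variable {ι : Type*} [Fintype ι] [DecidableEq ι] {r : ℕ} {α : ℝ}
  {v : ι → EuclideanSpace ℝ (Fin r)} {A : Matrix ι ι ℝ}

theorem inner_total (h : EquiangularGraph α v A) (i : ι) :
    inner ℝ (v i) (∑ j, v j) = 1 - α + α * Fintype.card ι - 2 * α * ∑ j, A i j := by
  have := h.inner_sum_smul (fun _ => 1) i
  simpa using this

theorem degree_le (h : EquiangularGraph α v A) (hα : 0 < α) (hα2 : α ≤ 1 / 2)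
    (hn : 32 / α ^ 4 ≤ Fintype.card ι) (hd : ∀ i, ∑ j, A i j ≤ (Fintype.card ι : ℝ) / 32) (i : ι) :
    ∑ j, A i j ≤ 1 / (4 * α ^ 3) := by
  set n : ℝ := ((Fintype.card ι : ℕ) : ℝ) with hn_def
  set D := ∑ j, A i j with hD
  set w := ∑ j, v j with hw
  have hα4 : 0 < α ^ 4 := by positivity
  have hn1 : 32 ≤ n * α ^ 4 := by rwa [div_le_iff₀ hα4] at hn
  have hn0 : 0 < n := by
    by_contra hc
    linarith [mul_nonneg (sub_nonneg.2 (not_lt.1 hc)) hα4.le]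
  have hD0 : 0 ≤ D := Finset.sum_nonneg fun j _ => h.nonneg i j
  have hDn : D ≤ n / 32 := hd i
  set a : ι → ℝ := fun k => inner ℝ (v k) w with ha
  have hak : ∀ k, a k = 1 - α + α * n - 2 * α * ∑ j, A k j := fun k => h.inner_total k
  have hbig : 256 ≤ α * n := by
    have : α ^ 3 ≤ 1 / 8 := by
      calc α ^ 3 ≤ (1 / 2) ^ 3 := by gcongr
        _ = 1 / 8 := by norm_num
    linarith [mul_nonneg (mul_pos hα hn0).le (sub_nonneg.2 this)]
  have hag : ∀ k, 15 / 16 * (α * n) ≤ a k := fun k => by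
    rw [hak]; linarith [mul_le_mul_of_nonneg_left (hd k) hα.le]
  have hab : ∀ k, a k ≤ 257 / 256 * (α * n) := fun k => by
    rw [hak]
    have : 0 ≤ ∑ j, A k j := Finset.sum_nonneg fun j _ => h.nonneg k j
    linarith [mul_nonneg hα.le this]
  have key := sq_sum_mul_inner_le v h.inner_self h.inner_sq (fun k => A i k - D / n) (v i) w
  have hsumc : ∑ k, (A i k - D / n) = 0 := by
    rw [Finset.sum_sub_distrib, ← hD]
    simp only [Finset.sum_const, Finset.card_univ, nsmul_eq_mul, ← hn_def]
    field_simp; ring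
  have hsumc2 : ∑ k, (A i k - D / n) ^ 2 = D - D ^ 2 / n := by
    have : ∀ k, (A i k - D / n) ^ 2 = A i k - 2 * (D / n) * A i k + D ^ 2 / n ^ 2 := fun k => by
      have := h.sq_entry i k
      linear_combination this
    simp only [this, Finset.sum_add_distrib, Finset.sum_sub_distrib, ← Finset.mul_sum, ← hD]
    simp only [Finset.sum_const, Finset.card_univ, nsmul_eq_mul, ← hn_def]
    field_simp; ring
  have hDn1 : D / n ≤ 1 := by rw [div_le_one hn0]; linarith
  have hDn0 : 0 ≤ D / n := by positivity
  have hlow : 2 * α * (15 / 16 * (α * n)) * (D - D ^ 2 / n) ≤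
      -∑ k, (A i k - D / n) * (inner ℝ (v i) (v k) * inner ℝ w (v k)) := by
    have hterm : ∀ k, α * (15 / 16 * (α * n)) * (A i k * (1 - D / n) + (1 - A i k) * (D / n)) ≤
        -((A i k - D / n) * (inner ℝ (v i) (v k) * inner ℝ w (v k))) := fun k => by
      rw [real_inner_comm (v k) w, show inner ℝ (v k) w = a k from rfl, h.gram]
      have h0 : 0 ≤ a k := le_trans (by positivity) (hag k)
      rcases h.entry i k with e | e
      · rw [e]
        have hcase : α * (15 / 16 * (α * n)) ≤
            ((1 - α) * (if i = k then 1 else 0) + α - 2 * α * 0) * a k := by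
          have : α ≤ (1 - α) * (if i = k then 1 else 0) + α - 2 * α * 0 := by
            split_ifs <;> linarith
          exact mul_le_mul this (hag k) (by positivity) (by linarith)
        have := mul_le_mul_of_nonneg_right hcase hDn0
        linarith
      · have hik : i ≠ k := by
          rintro rfl
          rw [h.diag] at e; norm_num at e
        rw [e, if_neg hik]
        have := mul_le_mul_of_nonneg_left (mul_le_mul_of_nonneg_left (hag k) hα.le)
          (sub_nonneg.2 hDn1)
        linarith
    have := Finset.sum_le_sum fun k (_ : k ∈ Finset.univ) => hterm k
    rw [Finset.sum_neg_distrib, ← Finset.mul_sum, Finset.sum_add_distrib, ← Finset.sum_mul,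
      ← Finset.sum_mul, Finset.sum_sub_distrib, ← hD] at this
    simp only [Finset.sum_const, Finset.card_univ, nsmul_eq_mul, ← hn_def] at this
    refine le_trans (le_of_eq ?_) this
    field_simp; ring
  rw [hsumc, hsumc2, h.inner_self] at key
  have hW : inner ℝ w w ≤ n * (257 / 256 * (α * n)) := by
    rw [show inner ℝ w w = ∑ k, a k by rw [hw, sum_inner]]
    refine le_trans (Finset.sum_le_sum fun k _ => hab k) (le_of_eq ?_)
    simp [hn_def]
  have hai0 : 0 ≤ a i := le_trans (by positivity) (hag i)
  have hai : inner ℝ (v i) w ^ 2 ≤ (257 / 256 * (α * n)) ^ 2 :=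
    pow_le_pow_left₀ hai0 (hab i) 2
  set q := D - D ^ 2 / n with hq
  have hq1 : 31 / 32 * D ≤ q := by
    have : D ^ 2 / n ≤ D / 32 := by
      rw [div_le_div_iff₀ hn0 (by norm_num)]; linarith [mul_le_mul_of_nonneg_left hDn hD0]
    linarith
  have hq0 : 0 ≤ q := by linarith
  have hsq : (2 * α * (15 / 16 * (α * n)) * q) ^ 2 ≤
      (∑ k, (A i k - D / n) * (inner ℝ (v i) (v k) * inner ℝ w (v k))) ^ 2 := by
    rw [← neg_sq (∑ k, _)]
    exact pow_le_pow_left₀ (by positivity) hlow 2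
  have hX : (1 * inner ℝ w w + inner ℝ (v i) w ^ 2) / 2 ≤ 0.757 * (α * n ^ 2) := by
    have : α ^ 2 * n ^ 2 ≤ 1 / 2 * (α * n ^ 2) := by
      have := mul_le_mul_of_nonneg_right hα2 (by positivity : 0 ≤ α * n ^ 2)
      linarith
    have h0 : 0 ≤ α * n ^ 2 := by positivity
    linarith
  have hfin : (2 * α * (15 / 16 * (α * n)) * q) ^ 2 ≤ 0.757 * (α * n ^ 2) * q := by
    refine hsq.trans (key.trans ?_)
    have : (1 - α ^ 2) * q + α ^ 2 * 0 ^ 2 ≤ q := by linarith [mul_nonneg (sq_nonneg α) hq0]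
    refine mul_le_mul hX this ?_ (by positivity)
    have : 0 ≤ 1 - α ^ 2 := by linarith [pow_le_one₀ (n := 2) hα.le (by linarith : α ≤ 1)]
    positivity
  rw [le_div_iff₀ (by positivity)]
  by_contra hc
  push Not at hc
  have hqp : 0 < q := by
    have : 0 < D := by
      by_contra h0
      have := mul_nonpos_of_nonpos_of_nonneg (not_lt.1 h0) (by positivity : 0 ≤ 4 * α ^ 3)
      linarith
    linarith
  have hpos : 0 < α * n ^ 2 * q := by positivity
  have : (α * n ^ 2 * q) * (4 * (15 / 16) ^ 2 * (α ^ 3 * q)) ≤ (α * n ^ 2 * q) * 0.757 := by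
    linarith
  have := le_of_mul_le_mul_left this hpos
  linarith [mul_le_mul_of_nonneg_left hq1 (pow_pos hα 3).le]

/-- The degree sequence has small variance. -/
theorem degree_variance_le (h : EquiangularGraph α v A) (hα : 0 < α) (hα2 : α ≤ 1 / 2)
    (hn : 32 / α ^ 4 ≤ Fintype.card ι) (hd : ∀ i, ∑ j, A i j ≤ (Fintype.card ι : ℝ) / 32)
    (d : ℝ) (hd0 : ∑ i, ∑ j, A i j = d * Fintype.card ι) :
    14 * α ^ 4 * ∑ i, (∑ j, A i j - d) ^ 2 ≤ Fintype.card ι * (1 + 4 * α ^ 2 * d) := by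
  set n : ℝ := ((Fintype.card ι : ℕ) : ℝ) with hn_def
  set w := ∑ j, v j with hw
  have hα4 : 0 < α ^ 4 := by positivity
  have hn1 : 32 ≤ n * α ^ 4 := by rwa [div_le_iff₀ hα4] at hn
  have hn0 : 0 < n := by
    by_contra hc
    linarith [mul_nonneg (sub_nonneg.2 (not_lt.1 hc)) hα4.le]
  set e : ι → ℝ := fun i => ∑ j, A i j - d with he
  set E := ∑ i, e i ^ 2 with hE
  have hE0 : 0 ≤ E := Finset.sum_nonneg fun i _ => sq_nonneg _
  have hse : ∑ i, e i = 0 := by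
    rw [he, Finset.sum_sub_distrib, hd0]; simp [hn_def]; ring
  have hdn : d ≤ n / 32 := by
    have := Finset.sum_le_sum fun k (_ : k ∈ Finset.univ) => hd k
    rw [hd0, Finset.sum_const, Finset.card_univ, nsmul_eq_mul, ← hn_def] at this
    exact le_of_mul_le_mul_right (by linarith) hn0
  have hd00 : 0 ≤ d := by
    have : 0 ≤ d * n := hd0 ▸ Finset.sum_nonneg fun i _ => Finset.sum_nonneg fun j _ => h.nonneg i j
    exact nonneg_of_mul_nonneg_left this hn0
  set a : ι → ℝ := fun k => inner ℝ w (v k) with ha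
  set m := 1 - α + α * n - 2 * α * d with hm
  have hak : ∀ k, a k = m - 2 * α * e k := fun k => by
    rw [ha]; simp only [real_inner_comm (v k) w]; rw [h.inner_total k]; simp only [he, hm]; ring
  have hmg : 15 / 16 * (α * n) ≤ m := by
    linarith [mul_le_mul_of_nonneg_left hdn hα.le]
  have hag : ∀ k, 15 / 16 * (α * n) ≤ a k := fun k => by
    rw [hak]; simp only [he, hm]
    linarith [mul_le_mul_of_nonneg_left (hd k) hα.le]
  set τ := 15 / 4 * α ^ 2 with hτ
  have hτ0 : 0 < τ := by positivity
  have key := sq_sum_mul_inner_le v h.inner_self h.inner_sq (fun k => 1 - τ * e k) w w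
  have hs1 : ∑ k, (1 - τ * e k) = n := by
    rw [Finset.sum_sub_distrib, ← Finset.mul_sum, hse]; simp [hn_def]
  have hs2 : ∑ k, (1 - τ * e k) ^ 2 = n + τ ^ 2 * E := by
    have : ∀ k, (1 - τ * e k) ^ 2 = 1 - 2 * τ * e k + τ ^ 2 * e k ^ 2 := fun k => by ring
    simp only [this, Finset.sum_add_distrib, Finset.sum_sub_distrib, ← Finset.mul_sum, hse, ← hE]
    simp [hn_def]
  have hW : inner ℝ w w = n * m := by
    rw [show inner ℝ w w = ∑ k, a k by rw [ha]; simp only [hw, inner_sum]]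
    simp only [hak, Finset.sum_sub_distrib, ← Finset.mul_sum, hse]
    simp [hn_def]
  have hlow : n * m ^ 2 + 15 / 4 * τ * α ^ 2 * n * E ≤
      ∑ k, (1 - τ * e k) * (inner ℝ w (v k) * inner ℝ w (v k)) := by
    have hterm : ∀ k, m ^ 2 - (4 * α * m + m ^ 2 * τ) * e k + 15 / 4 * τ * α ^ 2 * n * e k ^ 2 ≤
        (1 - τ * e k) * (inner ℝ w (v k) * inner ℝ w (v k)) := fun k => by
      rw [show inner ℝ w (v k) = a k from rfl]
      have h1 := hag k
      have h2 : 0 ≤ τ * (2 * α) * e k ^ 2 * (a k + m - 15 / 8 * (α * n)) :=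
        mul_nonneg (by positivity) (by linarith)
      have h3 : 0 ≤ (2 * α * e k) ^ 2 := sq_nonneg _
      rw [hak] at h2 ⊢
      linarith
    have := Finset.sum_le_sum fun k (_ : k ∈ Finset.univ) => hterm k
    simp only [Finset.sum_add_distrib, Finset.sum_sub_distrib, ← Finset.mul_sum, hse, ← hE] at this
    simpa [hn_def] using this
  rw [hs1, hs2, hW] at key
  have hm0 : 0 < m := lt_of_lt_of_le (by positivity) hmg
  have hsq := (pow_le_pow_left₀ (by positivity) hlow 2).trans key
  have hnm : 0 < n ^ 2 * m ^ 2 := by positivity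
  have h5 : (n ^ 2 * m ^ 2) * (m ^ 2 + 15 / 2 * τ * α ^ 2 * E) ≤
      (n ^ 2 * m ^ 2) * (n + τ ^ 2 * E + α ^ 2 * n ^ 2) := by
    have h6 : 0 ≤ (15 / 4 * τ * α ^ 2 * n * E) ^ 2 := sq_nonneg _
    have h7 : 0 ≤ (n ^ 2 * m ^ 2) * (α ^ 2 * (n + τ ^ 2 * E)) := by positivity
    linarith
  have h8 := le_of_mul_le_mul_left h5 hnm
  have h9 : α ^ 2 * n ^ 2 - 4 * α ^ 2 * n * d ≤ m ^ 2 := by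
    have h10 : α * (n - 2 * d) ≤ m := by rw [hm]; linarith
    have h11 : 0 ≤ α * (n - 2 * d) := mul_nonneg hα.le (by linarith)
    linarith [pow_le_pow_left₀ h11 h10 2, sq_nonneg (α * d)]
  rw [hτ] at h8
  linarith [mul_nonneg hα4.le hE0]

end EquiangularGraph

theorem sum_sub_mean_sq_le {ι : Type*} [Fintype ι] (y : ι → ℝ) :
    ∑ l, (y l - (∑ k, y k) / Fintype.card ι) ^ 2 ≤ ∑ l, y l ^ 2 := by
  rcases isEmpty_or_nonempty ι with h | h
  · simp
  have hn : (0 : ℝ) < Fintype.card ι := by exact_mod_cast Fintype.card_pos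
  set S := ∑ k, y k with hS
  have : ∀ l, (y l - S / Fintype.card ι) ^ 2 =
      y l ^ 2 - 2 * (S / Fintype.card ι) * y l + S ^ 2 / (Fintype.card ι) ^ 2 := fun l => by ring
  simp only [this, Finset.sum_add_distrib, Finset.sum_sub_distrib, ← Finset.mul_sum, ← hS]
  simp only [Finset.sum_const, Finset.card_univ, nsmul_eq_mul]
  have h1 : (Fintype.card ι : ℝ) * (S ^ 2 / (Fintype.card ι) ^ 2) = S ^ 2 / Fintype.card ι := by
    field_simp
  have h2 : 2 * (S / Fintype.card ι) * S = 2 * (S ^ 2 / Fintype.card ι) := by ring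
  have h3 : 0 ≤ S ^ 2 / (Fintype.card ι : ℝ) := by positivity
  rw [h1, h2]
  linarith

theorem average_degree_numeric {L l d n e : ℝ} (hL : 1 ≤ L) (hl : l = L - 1 / 2)
    (hn : 512 * L ^ 4 ≤ n) (hd : d ≤ 2 * L ^ 3) (he : e ≤ 8 / 7 * L ^ 2 * (L ^ 2 + d))
    (hmain : n * (2 * (l / d) * d - l - l * (l / d) ^ 2 * d) ≤
      2 * (d + 2 * (l / d) * (d ^ 2 + e) + (l / d) ^ 2 * (d ^ 3 + (2 * d + l) * e))) :
    d < 1.9 * l ^ 2 := by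
  by_contra hc
  push Not at hc
  have hl0 : 1 / 2 ≤ l := by linarith
  have hlL : L / 2 ≤ l := by linarith
  have hl2 : l ≤ L := by linarith
  have hlsq : L ^ 2 / 4 ≤ l ^ 2 := by nlinarith
  have hl2sq : l ^ 2 ≤ L ^ 2 := by nlinarith
  have hdpos : 0 < d := by nlinarith
  have hu : e / d ≤ 3.55 * L ^ 2 := by
    rw [div_le_iff₀ hdpos]
    have : L ^ 2 * L ^ 2 ≤ L ^ 2 * (d / 0.475) := by
      refine mul_le_mul_of_nonneg_left ?_ (by positivity)
      rw [le_div_iff₀ (by norm_num)]; linarith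
    have h0 : 0 ≤ L ^ 2 * d := by positivity
    have h1 : L ^ 2 * (d / 0.475) = L ^ 2 * d / 0.475 := by ring
    rw [h1] at this
    have h2 : L ^ 2 * d / 0.475 ≤ 2.1053 * (L ^ 2 * d) := by
      rw [div_le_iff₀ (by norm_num)]; linarith
    linarith
  have hld : l / d ≤ 1.06 := by
    rw [div_le_iff₀ hdpos]; nlinarith
  have hld0 : 0 ≤ l / d := by positivity
  have hlld : l ^ 2 / d ≤ 10 / 19 := by
    rw [div_le_iff₀ hdpos]; linarith
  have e1 : n * (2 * (l / d) * d - l - l * (l / d) ^ 2 * d) = n * (l * (1 - l ^ 2 / d)) := by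
    field_simp; ring
  have e2 : 2 * (d + 2 * (l / d) * (d ^ 2 + e) + (l / d) ^ 2 * (d ^ 3 + (2 * d + l) * e)) =
      2 * (d + 2 * l * d + 2 * l * (e / d) + l ^ 2 * d + l ^ 2 * (2 + l / d) * (e / d)) := by
    field_simp; ring
  rw [e1, e2] at hmain
  have hlow : 512 * L ^ 4 * (L / 2 * (9 / 19)) ≤ n * (l * (1 - l ^ 2 / d)) := by
    apply mul_le_mul hn _ (by positivity) (le_trans (by positivity) hn)
    exact mul_le_mul hlL (by linarith) (by norm_num) (by linarith)
  have b1 : d ≤ 2 * L ^ 5 := hd.trans (by gcongr; first | exact hL | norm_num)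
  have b2 : 2 * l * d ≤ 4 * L ^ 5 := by
    calc 2 * l * d ≤ 2 * L * (2 * L ^ 3) := by gcongr
      _ = 4 * L ^ 4 := by ring
      _ ≤ 4 * L ^ 5 := by gcongr; first | exact hL | norm_num
  have b3 : 2 * l * (e / d) ≤ 7.1 * L ^ 5 := by
    calc 2 * l * (e / d) ≤ 2 * l * (3.55 * L ^ 2) := by gcongr
      _ ≤ 2 * L * (3.55 * L ^ 2) := by gcongr
      _ = 7.1 * L ^ 3 := by ring
      _ ≤ 7.1 * L ^ 5 := by gcongr; first | exact hL | norm_num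
  have b4 : l ^ 2 * d ≤ 2 * L ^ 5 := by
    calc l ^ 2 * d ≤ L ^ 2 * (2 * L ^ 3) := by gcongr
      _ = 2 * L ^ 5 := by ring
  have b5 : l ^ 2 * (2 + l / d) * (e / d) ≤ 10.9 * L ^ 5 := by
    calc l ^ 2 * (2 + l / d) * (e / d) ≤ l ^ 2 * (2 + l / d) * (3.55 * L ^ 2) := by gcongr
      _ ≤ L ^ 2 * (2 + 1.06) * (3.55 * L ^ 2) := by gcongr
      _ = 10.863 * L ^ 4 := by ring
      _ ≤ 10.9 * L ^ 4 := by gcongr; norm_num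
      _ ≤ 10.9 * L ^ 5 := by gcongr; first | exact hL | norm_num
  have : 0 < L ^ 5 := by positivity
  linarith

namespace EquiangularGraph

variable {ι : Type*} [Fintype ι] [DecidableEq ι] {r : ℕ} {α : ℝ}
  {v : ι → EuclideanSpace ℝ (Fin r)} {A : Matrix ι ι ℝ}

theorem sum_degree_mul (h : EquiangularGraph α v A) (y : ι → ℝ) :
    ∑ i, ∑ k, A i k * y k = ∑ k, y k * ∑ j, A k j := by
  rw [Finset.sum_comm]
  refine Finset.sum_congr rfl fun k _ => ?_
  rw [Finset.mul_sum]
  exact Finset.sum_congr rfl fun j _ => by rw [h.symm j k]; ring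

theorem star_inequality (h : EquiangularGraph α v A) (hα : 0 < α) (hα1 : α ≤ 1) [Nonempty ι]
    (d : ℝ) (hd : ∑ i, ∑ j, A i j = d * Fintype.card ι) (E : ℝ)
    (hE : ∑ i, (∑ j, A i j - d) ^ 2 = E * Fintype.card ι) (l : ℝ) (hl : l = (1 - α) / (2 * α))
    (t : ℝ) (ht : 0 ≤ t) :
    Fintype.card ι * (2 * t * d - l - l * t ^ 2 * d) ≤
      2 * (d + 2 * t * (d ^ 2 + E) + t ^ 2 * (d ^ 3 + (2 * d + l) * E)) := by
  set n : ℝ := ((Fintype.card ι : ℕ) : ℝ) with hn_def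
  have hn : 0 < n := by rw [hn_def]; exact_mod_cast Fintype.card_pos
  have hl0 : 0 ≤ l := by rw [hl]; exact div_nonneg (by linarith) (by linarith)
  set δ : ι → ℝ := fun i => ∑ j, A i j with hδ
  have hδ0 : ∀ i, 0 ≤ δ i := fun i => Finset.sum_nonneg fun j _ => h.nonneg i j
  have hδsq : ∑ i, δ i ^ 2 = n * (d ^ 2 + E) := by
    have : ∀ i, (δ i - d) ^ 2 = δ i ^ 2 - 2 * d * δ i + d ^ 2 := fun i => by ring
    have hE' : ∑ i, (δ i - d) ^ 2 = E * n := hE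
    have hd' : ∑ i, δ i = d * n := hd
    simp only [this, Finset.sum_add_distrib, Finset.sum_sub_distrib, ← Finset.mul_sum, hd',
      Finset.sum_const, Finset.card_univ, nsmul_eq_mul, ← hn_def] at hE'
    linarith
  set B : ι → ℝ := fun i => ∑ k, A i k * δ k with hB
  have hsB : ∑ i, B i = n * (d ^ 2 + E) := by
    rw [← hδsq, hB, h.sum_degree_mul]
    exact Finset.sum_congr rfl fun k _ => by rw [sq]
  have hδB : ∑ i, δ i * B i ≤ n * (d ^ 3 + (2 * d + l) * E) := by
    have key := h.quadratic_sub_const_le hα δ d hd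
    rw [← hl, hd] at key
    have e1 : ∑ i, δ i * ∑ j, A i j = n * (d ^ 2 + E) := by
      rw [← hδsq]; exact Finset.sum_congr rfl fun k _ => by rw [sq]
    have e2 : ∑ i, ∑ j, δ i * A i j * δ j = ∑ i, δ i * B i := by
      refine Finset.sum_congr rfl fun k _ => ?_
      rw [hB, Finset.mul_sum]; exact Finset.sum_congr rfl fun j _ => by ring
    rw [e1, e2, hδsq, ← hn_def] at key
    linarith
  have hi : ∀ i, 2 * t * δ i - 2 / n * ((1 + t * δ i) * (δ i + t * B i)) ≤
      l * (1 + t ^ 2 * δ i) := fun i => by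
    set x : ι → ℝ := fun k => (if k = i then 1 else 0) + t * A i k with hx
    have hsx : ∑ k, x k = (1 + t * δ i) / n * n := by
      rw [div_mul_cancel₀ _ hn.ne']
      simp [hx, Finset.sum_add_distrib, ← Finset.mul_sum, hδ]
    have key := h.quadratic_sub_const_le hα x ((1 + t * δ i) / n) hsx
    rw [← hl, hd] at key
    have hsx2 : ∑ k, x k ^ 2 = 1 + t ^ 2 * δ i := by
      have : ∀ k, x k ^ 2 = (if k = i then 1 + 2 * t * A i k else 0) + t ^ 2 * A i k := fun k => by
        have := h.sq_entry i k
        simp only [hx]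
        split_ifs <;> linear_combination t ^ 2 * this
      simp [this, Finset.sum_add_distrib, ← Finset.mul_sum, hδ, h.diag]
    have hxd : ∑ k, x k * ∑ j, A k j = δ i + t * B i := by
      have : ∀ k, x k * ∑ j, A k j = (if k = i then δ k else 0) + t * (A i k * δ k) := fun k => by
        simp only [hx, hδ]; split_ifs <;> ring
      simp [this, Finset.sum_add_distrib, ← Finset.mul_sum, hB]
    have hq : 2 * t * δ i ≤ ∑ k, ∑ j, x k * A k j * x j := by
      have hterm : ∀ k j, (if k = i then t * (A i j * A i j) else 0) +
          (if j = i then t * (A i k * A i k) else 0) ≤ x k * A k j * x j := fun k j => by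
        have a1 := h.nonneg i k
        have a2 := h.nonneg i j
        have a3 := h.nonneg k j
        simp only [hx]
        split_ifs with c1 c2 c2
        · subst c1; subst c2; simp [h.diag]
        · subst c1; simp [h.diag]; linarith
        · subst c2; simp [h.diag, h.symm k j]; linarith
        · simp only [zero_add, add_zero]; positivity
      have := Finset.sum_le_sum fun k (_ : k ∈ Finset.univ) =>
        Finset.sum_le_sum fun j (_ : j ∈ Finset.univ) => hterm k j
      refine le_trans (le_of_eq ?_) this
      simp only [h.sq_entry, Finset.sum_add_distrib, Finset.sum_ite_eq', Finset.mem_univ, if_true,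
        ← Finset.mul_sum]
      have : ∑ x, ∑ x_1, (if x = i then t * A i x_1 else 0) = t * δ i := by
        rw [Finset.sum_eq_single i]
        · simp [hδ, ← Finset.mul_sum]
        · intro b _ hb; simp [hb]
        · simp
      rw [this]
      simp only [hδ]; ring
    rw [hsx2, hxd] at key
    have hd0 : 0 ≤ d * n := hd ▸ Finset.sum_nonneg fun i _ => hδ0 i
    have p1 : 0 ≤ ((1 + t * δ i) / n) ^ 2 * (d * n) := by positivity
    have p2 : 0 ≤ l * (((1 + t * δ i) / n) ^ 2 * n) := by positivity
    have p3 : 2 / n * ((1 + t * δ i) * (δ i + t * B i)) =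
      2 * ((1 + t * δ i) / n) * (δ i + t * B i) := by ring
    rw [p3]
    rw [← hn_def] at key
    linarith
  have hsum := Finset.sum_le_sum fun i (_ : i ∈ Finset.univ) => hi i
  have e3 : ∀ i, (1 + t * δ i) * (δ i + t * B i) =
    δ i + t * B i + t * δ i ^ 2 + t ^ 2 * (δ i * B i) := fun i => by ring
  have hd' : ∑ i, δ i = d * n := hd
  simp only [e3, Finset.sum_sub_distrib, Finset.sum_add_distrib, ← Finset.mul_sum, hd', hsB,
    hδsq, Finset.sum_const, Finset.card_univ, nsmul_eq_mul, ← hn_def] at hsum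
  have h4 : 2 / n * (d * n + t * (n * (d ^ 2 + E)) + t * (n * (d ^ 2 + E)) +
      t ^ 2 * ∑ i, δ i * B i) ≤
      2 / n * (n * (d + 2 * t * (d ^ 2 + E) + t ^ 2 * (d ^ 3 + (2 * d + l) * E))) := by
    refine mul_le_mul_of_nonneg_left ?_ (by positivity)
    have := mul_le_mul_of_nonneg_left hδB (sq_nonneg t)
    linarith
  have h5 : 2 / n * (n * (d + 2 * t * (d ^ 2 + E) + t ^ 2 * (d ^ 3 + (2 * d + l) * E))) =
      2 * (d + 2 * t * (d ^ 2 + E) + t ^ 2 * (d ^ 3 + (2 * d + l) * E)) := by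
    field_simp
  linarith

theorem trace_inequality (h : EquiangularGraph α v A) [Nonempty ι]
    (d : ℝ) (hd : ∑ i, ∑ j, A i j = d * Fintype.card ι) :
    ((1 - α) * (Fintype.card ι - 1) + 2 * α * d) ^ 2 ≤
      r * (Fintype.card ι * ((1 - α) ^ 2 + 4 * α ^ 2 * d)) := by
  have hn : (0 : ℝ) < Fintype.card ι := by exact_mod_cast Fintype.card_pos
  set w := ∑ j, v j with hw
  let u : ι → EuclideanSpace ℝ (Fin r) := fun k => v k - (1 / (Fintype.card ι : ℝ)) • w
  have key := sq_sum_inner_self_le u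
  have hsu : ∑ k, u k = 0 := by
    simp only [u, Finset.sum_sub_distrib, ← hw, Finset.sum_const, Finset.card_univ]
    rw [← Nat.cast_smul_eq_nsmul ℝ, smul_smul, mul_one_div_cancel hn.ne', one_smul, sub_self]
  have hvu : ∀ k l, inner ℝ (v k) (u l) = (inner ℝ (v k) (v l) - α) -
      (∑ j, (inner ℝ (v k) (v j) - α)) / Fintype.card ι := fun k l => by
    simp only [u, inner_sub_right, inner_smul_right, hw, _root_.inner_sum,
      Finset.sum_sub_distrib, Finset.sum_const, Finset.card_univ, nsmul_eq_mul]
    field_simp; ring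
  have huu : ∀ k l, inner ℝ (u k) (u l) = inner ℝ (v k) (u l) -
      (∑ j, inner ℝ (v j) (u l)) / Fintype.card ι := fun k l => by
    rw [← sum_inner, ← hw]
    simp only [u, inner_sub_left, inner_smul_left, conj_trivial]
    field_simp
  have htr : ∑ k, inner ℝ (u k) (u k) = (1 - α) * (Fintype.card ι - 1) + 2 * α * d := by
    have e1 : ∀ k, inner ℝ (u k) (u k) = inner ℝ (v k) (u k) -
        (1 / (Fintype.card ι : ℝ)) * inner ℝ w (u k) := fun k => by
      change inner ℝ (v k - (1 / (Fintype.card ι : ℝ)) • w) (u k) = _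
      rw [inner_sub_left, inner_smul_left, conj_trivial]
    simp only [e1, Finset.sum_sub_distrib, ← Finset.mul_sum, ← _root_.inner_sum, hsu,
      inner_zero_right, mul_zero, sub_zero]
    have e2 : ∀ k, inner ℝ (v k) (u k) = 1 - (1 / (Fintype.card ι : ℝ)) *
        (1 - α + α * Fintype.card ι - 2 * α * ∑ j, A k j) := fun k => by
      rw [← h.inner_total k, ← hw]
      nth_rewrite 1 [← h.inner_self k]
      simp only [u, inner_sub_right, inner_smul_right]
    simp only [e2, Finset.sum_sub_distrib, ← Finset.mul_sum, hd, Finset.sum_const,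
      Finset.card_univ, nsmul_eq_mul]
    field_simp; ring
  have hsq : ∑ k, ∑ l, inner ℝ (u k) (u l) ^ 2 ≤
      Fintype.card ι * ((1 - α) ^ 2 + 4 * α ^ 2 * d) := by
    calc ∑ k, ∑ l, inner ℝ (u k) (u l) ^ 2
        = ∑ l, ∑ k, inner ℝ (u k) (u l) ^ 2 := Finset.sum_comm
      _ ≤ ∑ l, ∑ k, inner ℝ (v k) (u l) ^ 2 := by
          refine Finset.sum_le_sum fun l _ => ?_
          simp only [huu]
          exact sum_sub_mean_sq_le fun k => inner ℝ (v k) (u l)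
      _ = ∑ k, ∑ l, inner ℝ (v k) (u l) ^ 2 := Finset.sum_comm
      _ ≤ ∑ k, ∑ l, (inner ℝ (v k) (v l) - α) ^ 2 := by
          refine Finset.sum_le_sum fun k _ => ?_
          simp only [hvu]
          exact sum_sub_mean_sq_le fun l => inner ℝ (v k) (v l) - α
      _ = Fintype.card ι * ((1 - α) ^ 2 + 4 * α ^ 2 * d) := by
          have : ∀ k l, (inner ℝ (v k) (v l) - α) ^ 2 =
              (if k = l then (1 - α) ^ 2 else 0) + 4 * α ^ 2 * A k l := fun k l => by
            rw [h.gram]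
            have e := h.sq_entry k l
            split_ifs with c
            · subst c; rw [h.diag]; ring
            · linear_combination 4 * α ^ 2 * e
          simp only [this, Finset.sum_add_distrib, Finset.sum_ite_eq, Finset.mem_univ, if_true,
            ← Finset.mul_sum, hd, Finset.sum_const, Finset.card_univ, nsmul_eq_mul]
          ring
  rw [htr] at key
  exact key.trans (mul_le_mul_of_nonneg_left hsq (Nat.cast_nonneg r))

/-- With all degrees small compared to their number, there are at most `3 r` lines. -/
theorem card_le_three_mul (h : EquiangularGraph α v A) (hα : 0 < α) (hα2 : α ≤ 1 / 2)
    (hn : 32 / α ^ 4 ≤ Fintype.card ι)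
    (hd : ∀ i, ∑ j, A i j ≤ (Fintype.card ι : ℝ) / 32) : Fintype.card ι ≤ 3 * r := by
  have hα4 : 0 < α ^ 4 := by positivity
  have hn0 : (0 : ℝ) < Fintype.card ι := lt_of_lt_of_le (by positivity) hn
  have : Nonempty ι := Fintype.card_pos_iff.1 (by exact_mod_cast hn0)
  set d := (∑ i, ∑ j, A i j) / Fintype.card ι with hd_def
  have hd0 : ∑ i, ∑ j, A i j = d * Fintype.card ι := by rw [hd_def]; field_simp
  set E := (∑ i, (∑ j, A i j - d) ^ 2) / Fintype.card ι with hE_def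
  have hE0 : ∑ i, (∑ j, A i j - d) ^ 2 = E * Fintype.card ι := by rw [hE_def]; field_simp
  have hdnn : 0 ≤ d := div_nonneg
    (Finset.sum_nonneg fun i _ => Finset.sum_nonneg fun j _ => h.nonneg i j) hn0.le
  have hvar := h.degree_variance_le hα hα2 hn hd d hd0
  rw [hE0] at hvar
  have hvar' : 14 * α ^ 4 * E ≤ 1 + 4 * α ^ 2 * d :=
    le_of_mul_le_mul_left (by linarith) hn0
  set L := 1 / (2 * α) with hL
  have hαL : α = 1 / (2 * L) := by rw [hL]; field_simp
  have hL1 : 1 ≤ L := by rw [hL, le_div_iff₀ (by linarith)]; linarith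
  set l := (1 - α) / (2 * α) with hl
  have hlL : l = L - 1 / 2 := by rw [hl, hL]; field_simp
  have hdle : d ≤ 2 * L ^ 3 := by
    rw [hd_def, div_le_iff₀ hn0]
    have := Finset.sum_le_sum fun i (_ : i ∈ Finset.univ) => h.degree_le hα hα2 hn hd i
    rw [Finset.sum_const, Finset.card_univ, nsmul_eq_mul] at this
    refine this.trans (le_of_eq ?_)
    rw [hL]; field_simp; ring
  have hd19 : d < 1.9 * l ^ 2 := by
    refine average_degree_numeric (n := Fintype.card ι) (e := E) hL1 hlL ?_ hdle ?_ ?_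
    · refine le_trans (le_of_eq ?_) hn
      rw [hL]; field_simp; norm_num
    · have : 14 * α ^ 4 * E * (8 / 7 * L ^ 4) ≤ (1 + 4 * α ^ 2 * d) * (8 / 7 * L ^ 4) :=
        mul_le_mul_of_nonneg_right hvar' (by positivity)
      have e1 : 14 * α ^ 4 * E * (8 / 7 * L ^ 4) = E := by rw [hL]; field_simp; ring
      have e2 : (1 + 4 * α ^ 2 * d) * (8 / 7 * L ^ 4) = 8 / 7 * L ^ 2 * (L ^ 2 + d) := by
        rw [hαL]; field_simp; ring
      rwa [e1, e2] at this
    · have hl0 : 0 ≤ l := by rw [hlL]; linarith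
      exact h.star_inequality hα (by linarith) d hd0 E hE0 l hl (l / d) (by positivity)
  have htr := h.trace_inequality d hd0
  set n : ℝ := ((Fintype.card ι : ℕ) : ℝ) with hn_def
  have h4 : 4 * α ^ 2 * d ≤ 1.9 * (1 - α) ^ 2 := by
    have e : 4 * α ^ 2 * (1.9 * l ^ 2) = 1.9 * (1 - α) ^ 2 := by rw [hl]; field_simp; ring
    have := mul_le_mul_of_nonneg_left hd19.le (by positivity : 0 ≤ 4 * α ^ 2)
    linarith
  have hn512 : 512 ≤ n := by
    refine le_trans ?_ hn
    rw [le_div_iff₀ hα4]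
    have : α ^ 4 ≤ (1 / 2) ^ 4 := by gcongr
    linarith
  have h1α : 0 < (1 - α) ^ 2 := by have : 0 < 1 - α := by linarith
                                   positivity
  have h5 : (1 - α) ^ 2 * (n - 1) ^ 2 ≤ (1 - α) ^ 2 * (2.9 * (r * n)) := by
    have p1 : (1 - α) ^ 2 * (n - 1) ^ 2 ≤ ((1 - α) * (n - 1) + 2 * α * d) ^ 2 := by
      rw [← mul_pow]
      refine pow_le_pow_left₀ (mul_nonneg (by linarith) (by linarith)) ?_ 2
      have : 0 ≤ 2 * α * d := by positivity
      linarith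
    have p2 : (r : ℝ) * (n * ((1 - α) ^ 2 + 4 * α ^ 2 * d)) ≤ r * (n * (2.9 * (1 - α) ^ 2)) := by
      gcongr; linarith
    linarith
  have h6 := le_of_mul_le_mul_left h5 h1α
  have h7 : n - 2 ≤ 2.9 * r := by
    refine le_of_mul_le_mul_right ?_ hn0
    linarith
  by_contra hc
  push Not at hc
  have h8 : (3 * r + 1 : ℝ) ≤ n := by rw [hn_def]; exact_mod_cast hc
  linarith

end EquiangularGraph

theorem exists_equiangularGraph_of_inner {ι : Type*} [DecidableEq ι] {r : ℕ} {α : ℝ}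
    (v : ι → EuclideanSpace ℝ (Fin r)) (h1 : ∀ i, inner ℝ (v i) (v i) = 1)
    (h2 : ∀ i j, i ≠ j → inner ℝ (v i) (v j) = α ∨ inner ℝ (v i) (v j) = -α) :
    ∃ A, EquiangularGraph α v A := by
  classical
  refine ⟨Matrix.of fun i j => if i ≠ j ∧ inner ℝ (v i) (v j) ≠ α then 1 else 0, ?_, ?_, ?_, ?_⟩
  · intro i j
    simp only [Matrix.of_apply, ne_comm (a := i), real_inner_comm (v i)]
  · intro i j
    rw [Matrix.of_apply]
    split_ifs <;> simp
  · intro i; simp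
  · intro i j
    by_cases hij : i = j
    · subst hij; rw [h1]; simp
    · rcases h2 i j hij with e | e
      · simp [hij, e]
      · by_cases hα : -α = α
        · have : α = 0 := by linarith
          simp [hij, e, this]
        · simp [hij, e, hα]; ring

theorem inner_smul_sign {ι : Type*} {r : ℕ} {α : ℝ}
    {v : ι → EuclideanSpace ℝ (Fin r)} (h1 : ∀ i, inner ℝ (v i) (v i) = 1)
    (h2 : ∀ i j, i ≠ j → inner ℝ (v i) (v j) = α ∨ inner ℝ (v i) (v j) = -α)
    (s : ι → ℝ) (hs : ∀ i, s i = 1 ∨ s i = -1) :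
    (∀ i, inner ℝ (s i • v i) (s i • v i) = 1) ∧
      ∀ i j, i ≠ j → inner ℝ (s i • v i) (s j • v j) = α ∨ inner ℝ (s i • v i) (s j • v j) = -α := by
  simp only [inner_smul_left, inner_smul_right, conj_trivial, h1]
  refine ⟨fun i => ?_, fun i j hij => ?_⟩
  · rcases hs i with e | e <;> rw [e] <;> norm_num
  · rcases hs i with e | e <;> rcases hs j with e' | e' <;> rcases h2 i j hij with e2 | e2 <;>
      rw [e, e', e2] <;> norm_num

/-- One vector can be made to have positive inner product with all others. -/
theorem exists_equiangularGraph_of_base {ι : Type*} [DecidableEq ι] {r : ℕ} {α : ℝ}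
    (hα : 0 < α) (u : ι → EuclideanSpace ℝ (Fin r)) (h1 : ∀ i, inner ℝ (u i) (u i) = 1)
    (h2 : ∀ i j, i ≠ j → inner ℝ (u i) (u j) = α ∨ inner ℝ (u i) (u j) = -α) (i₀ : ι) :
    ∃ (v : ι → EuclideanSpace ℝ (Fin r)) (A : Matrix ι ι ℝ), EquiangularGraph α v A ∧
      ∀ j, A i₀ j = 0 := by
  classical
  let s : ι → ℝ := fun i => if inner ℝ (u i₀) (u i) < 0 then -1 else 1
  have hs : ∀ i, s i = 1 ∨ s i = -1 := fun i => by dsimp only [s]; split_ifs <;> simp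
  obtain ⟨g1, g2⟩ := inner_smul_sign h1 h2 s hs
  obtain ⟨A, hA⟩ := exists_equiangularGraph_of_inner _ g1 g2
  refine ⟨_, A, hA, fun j => ?_⟩
  by_cases hj : i₀ = j
  · subst hj; exact hA.diag _
  · have := hA.gram i₀ j
    rw [if_neg hj] at this
    rcases hA.entry i₀ j with e | e
    · exact e
    · exfalso
      have h0 : s i₀ = 1 := by simp [s]
      rw [e, h0, one_smul, inner_smul_right] at this
      dsimp only [s] at this
      split_ifs at this with hc <;> linarith

namespace EquiangularGraph

variable {ι : Type*} [DecidableEq ι] {r : ℕ} {α : ℝ}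
  {v : ι → EuclideanSpace ℝ (Fin r)} {A : Matrix ι ι ℝ}

theorem eq_zero_of_half_lt (h : EquiangularGraph α v A) (hα : 1 / 2 < α) (i₀ : ι)
    (h0 : ∀ j, A i₀ j = 0) (i j : ι) : A i j = 0 := by
  rcases h.entry i j with e | e
  · exact e
  exfalso
  have hij : i ≠ j := by rintro rfl; rw [h.diag] at e; norm_num at e
  have hi : i₀ ≠ i := by rintro rfl; rw [h0] at e; norm_num at e
  have hj : i₀ ≠ j := by rintro rfl; rw [h.symm, h0] at e; norm_num at e
  have g1 := h.gram i j
  have g2 := h.gram i₀ i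
  have g3 := h.gram i₀ j
  rw [if_neg hij, e] at g1
  rw [if_neg hi, h0] at g2
  rw [if_neg hj, h0] at g3
  have key : (0 : ℝ) ≤ inner ℝ (v i + v j - (2 * α) • v i₀) (v i + v j - (2 * α) • v i₀) :=
    real_inner_self_nonneg
  simp only [inner_sub_left, inner_sub_right, inner_add_left, inner_add_right, inner_smul_left,
    inner_smul_right, conj_trivial, h.inner_self, real_inner_comm (v i₀) (v i),
    real_inner_comm (v i₀) (v j), real_inner_comm (v i) (v j), g1, g2, g3] at key
  nlinarith

variable [Fintype ι]

theorem card_le_of_eq_zero (h : EquiangularGraph α v A) (hα : 0 < α) (hα1 : α < 1)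
    (hA : ∀ i j, A i j = 0) : Fintype.card ι ≤ r := by
  have hli : LinearIndependent ℝ v := by
    rw [Fintype.linearIndependent_iff]
    intro x hx i
    have key : ∀ i, (1 - α) * x i + α * ∑ j, x j = 0 := fun i => by
      have := h.inner_sum_smul x i
      rw [hx, inner_zero_right] at this
      simp only [hA, zero_mul, Finset.sum_const_zero, mul_zero, sub_zero] at this
      exact this.symm
    have hs := Finset.sum_congr (rfl : (Finset.univ : Finset ι) = _) fun i _ => key i
    rw [Finset.sum_add_distrib, ← Finset.mul_sum] at hs
    simp only [Finset.sum_const, Finset.card_univ, nsmul_eq_mul, mul_zero] at hs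
    have h0 : ∑ j, x j = 0 := by
      have h3 : (1 - α + Fintype.card ι * α) * ∑ j, x j = 0 := by linarith
      have h4 : 0 < 1 - α + Fintype.card ι * α := by
        have : (0 : ℝ) ≤ Fintype.card ι * α := by positivity
        linarith
      exact (mul_eq_zero.1 h3).resolve_left h4.ne'
    have := key i
    rw [h0, mul_zero, add_zero] at this
    exact (mul_eq_zero.1 this).resolve_left (by linarith)
  simpa using hli.fintype_card_le_finrank

theorem degree_dichotomy (h : EquiangularGraph α v A) (hα : 0 < α) (hα2 : α ≤ 1 / 2)
    (hn : 32 / α ^ 4 ≤ Fintype.card ι) (i₀ : ι) (h0 : ∀ j, A i₀ j = 0) (i : ι) :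
    ∑ j, A i j ≤ (Fintype.card ι : ℝ) / 128 ∨
      (Fintype.card ι : ℝ) - (Fintype.card ι : ℝ) / 128 ≤ ∑ j, A i j := by
  have hα4 : 0 < α ^ 4 := by positivity
  set n : ℝ := ((Fintype.card ι : ℕ) : ℝ) with hn_def
  have hn0 : 0 < n := lt_of_lt_of_le (by positivity) hn
  have hn1 : 32 ≤ n * α ^ 4 := by rwa [div_le_iff₀ hα4] at hn
  by_cases hii : i₀ = i
  · left; subst hii; simp only [h0, Finset.sum_const_zero]; positivity
  set D := ∑ j, A i j with hD
  have hD0 : 0 ≤ D := Finset.sum_nonneg fun j _ => h.nonneg i j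
  have hDn : D ≤ n := by
    have : ∑ j, A i j ≤ ∑ j : ι, (1 : ℝ) := Finset.sum_le_sum fun j _ => by
      rcases h.entry i j with e | e <;> rw [e] <;> norm_num
    simpa [hn_def] using this
  set T := n - 2 * D with hT
  have hσ : ∀ k, (1 - 2 * A i k) ^ 2 = 1 := fun k => by
    linear_combination 4 * h.sq_entry i k
  have hsσ : ∑ k, (1 - 2 * A i k) = T := by
    rw [Finset.sum_sub_distrib, ← Finset.mul_sum]; simp [hn_def, hT, hD]
  have key := sq_sum_mul_inner_le v h.inner_self h.inner_sq (fun k => (1 - 2 * A i k) - T / n)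
    (v i) (v i₀)
  have hc1 : ∑ k, ((1 - 2 * A i k) - T / n) = 0 := by
    rw [Finset.sum_sub_distrib, hsσ]
    simp only [Finset.sum_const, Finset.card_univ, nsmul_eq_mul, ← hn_def]
    field_simp; ring
  have hc2 : ∑ k, ((1 - 2 * A i k) - T / n) ^ 2 = n - T ^ 2 / n := by
    have : ∀ k, ((1 - 2 * A i k) - T / n) ^ 2 =
        1 - 2 * (T / n) * (1 - 2 * A i k) + T ^ 2 / n ^ 2 := fun k => by
      linear_combination hσ k
    rw [Finset.sum_congr rfl fun k _ => this k, Finset.sum_add_distrib, Finset.sum_sub_distrib,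
      ← Finset.mul_sum, hsσ]
    simp only [Finset.sum_const, Finset.card_univ, nsmul_eq_mul, ← hn_def, mul_one]
    field_simp; ring
  have hTn : |T| ≤ n := by rw [abs_le]; constructor <;> linarith
  have hlow : α ^ 2 * (n - T ^ 2 / n) ≤
      ∑ k, ((1 - 2 * A i k) - T / n) * (inner ℝ (v i) (v k) * inner ℝ (v i₀) (v k)) := by
    have hterm : ∀ k, α ^ 2 * (1 - (1 - 2 * A i k) * (T / n)) ≤
        ((1 - 2 * A i k) - T / n) * (inner ℝ (v i) (v k) * inner ℝ (v i₀) (v k)) := fun k => by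
      have hf : α ^ 2 ≤ (1 - 2 * A i k) * (inner ℝ (v i) (v k) * inner ℝ (v i₀) (v k)) := by
        rw [h.gram, h.gram, h0]
        by_cases c1 : i = k
        · subst c1
          rw [if_pos rfl, if_neg hii, h.diag]
          nlinarith
        · by_cases c2 : i₀ = k
          · subst c2
            rw [if_pos rfl, if_neg c1, h.symm, h0]
            nlinarith
          · rw [if_neg c1, if_neg c2]
            linarith [congrArg (α ^ 2 * ·) (hσ k)]
      have hfac : 0 ≤ 1 - (1 - 2 * A i k) * (T / n) := by
        have : |(1 - 2 * A i k) * (T / n)| ≤ 1 := by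
          rw [abs_mul, abs_div, abs_of_pos hn0]
          have e : |1 - 2 * A i k| = 1 := by
            rw [← sq_eq_sq₀ (abs_nonneg _) zero_le_one, sq_abs, hσ, one_pow]
          rw [e, one_mul]
          exact (div_le_one hn0).2 hTn
        linarith [le_abs_self ((1 - 2 * A i k) * (T / n))]
      have := mul_le_mul_of_nonneg_right hf hfac
      refine le_trans this (le_of_eq ?_)
      linear_combination
        (-(T / n) * (inner ℝ (v i) (v k) * inner ℝ (v i₀) (v k))) * hσ k
    have := Finset.sum_le_sum fun k (_ : k ∈ Finset.univ) => hterm k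
    rw [← Finset.mul_sum, Finset.sum_sub_distrib, ← Finset.sum_mul, hsσ] at this
    simp only [Finset.sum_const, Finset.card_univ, nsmul_eq_mul, ← hn_def, mul_one] at this
    rwa [show T ^ 2 / n = T * (T / n) by ring]
  rw [hc1, hc2, h.inner_self, h.inner_self, h.inner_sq i i₀ (Ne.symm hii)] at key
  set q := n - T ^ 2 / n with hq
  have hq0 : 0 ≤ q := by
    rw [hq, sub_nonneg, div_le_iff₀ hn0, ← sq, ← sq_abs]
    exact pow_le_pow_left₀ (abs_nonneg _) hTn 2
  have hsq := (pow_le_pow_left₀ (by positivity) hlow 2).trans key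
  have hq1 : α ^ 4 * q ≤ 1 / 2 := by
    rcases hq0.eq_or_lt with e | e
    · rw [← e]; norm_num
    · refine le_of_mul_le_mul_right ?_ e
      have : 0 ≤ α ^ 4 * q := by positivity
      linarith
  have hq2 : q ≤ n / 64 := by
    refine le_of_mul_le_mul_left ?_ hα4
    linarith
  have hT2 : 63 / 64 * n ^ 2 ≤ T ^ 2 := by
    have : T ^ 2 / n * n = T ^ 2 := div_mul_cancel₀ _ hn0.ne'
    have h3 : (63 / 64 * n) * n ≤ T ^ 2 / n * n :=
      mul_le_mul_of_nonneg_right (by linarith) hn0.le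
    linarith
  by_contra hcon
  push Not at hcon
  have : |T| < 63 / 64 * n := by rw [abs_lt]; constructor <;> linarith
  have h9 := pow_lt_pow_left₀ this (abs_nonneg _) two_ne_zero
  rw [sq_abs] at h9
  have : 0 < n ^ 2 := by positivity
  linarith

/-- The vectors can be signed so that all degrees are small. -/
theorem exists_small_degrees (h : EquiangularGraph α v A) (hα : 0 < α) (hα2 : α ≤ 1 / 2)
    (hn : 32 / α ^ 4 ≤ Fintype.card ι) (i₀ : ι) (h0 : ∀ j, A i₀ j = 0) :
    ∃ (v' : ι → EuclideanSpace ℝ (Fin r)) (A' : Matrix ι ι ℝ), EquiangularGraph α v' A' ∧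
      ∀ i, ∑ j, A' i j ≤ (Fintype.card ι : ℝ) / 32 := by
  classical
  have hdich := h.degree_dichotomy hα hα2 hn i₀ h0
  have hα4 : 0 < α ^ 4 := by positivity
  set n : ℝ := ((Fintype.card ι : ℕ) : ℝ) with hn_def
  have hn0 : 0 < n := lt_of_lt_of_le (by positivity) hn
  have hn1 : 32 ≤ n * α ^ 4 := by rwa [div_le_iff₀ hα4] at hn
  set Q : ι → ℝ := fun i => if n / 128 < ∑ j, A i j then 1 else 0 with hQ
  have hQ01 : ∀ i, Q i = 0 ∨ Q i = 1 := fun i => by simp only [hQ]; split_ifs <;> simp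
  have hQ0 : ∀ i, 0 ≤ Q i := fun i => by rcases hQ01 i with e | e <;> simp [e]
  have hQ1 : ∀ i, Q i ≤ 1 := fun i => by rcases hQ01 i with e | e <;> simp [e]
  have hQsq : ∀ i, Q i ^ 2 = Q i := fun i => by rcases hQ01 i with e | e <;> simp [e]
  have hA1 : ∀ i j, A i j ≤ 1 := fun i j => by rcases h.entry i j with e | e <;> simp [e]
  set a := ∑ i, Q i with ha
  have ha0 : 0 ≤ a := Finset.sum_nonneg fun i _ => hQ0 i
  have hquad := h.quadratic_le hα Q
  simp only [hQsq, ← ha] at hquad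
  have hlow : a * (n - n / 128) - a * (n - a) ≤ ∑ i, ∑ j, Q i * A i j * Q j := by
    have hrow : ∀ i, Q i * (n - n / 128) - Q i * (n - a) ≤ ∑ j, Q i * A i j * Q j := fun i => by
      have e1 : ∑ j, Q i * A i j * (1 - Q j) ≤ Q i * (n - a) := by
        have e : Q i * (n - a) = ∑ j, Q i * (1 - Q j) := by
          rw [← Finset.mul_sum, Finset.sum_sub_distrib]; simp [hn_def, ha]
        rw [e]
        refine Finset.sum_le_sum fun j _ => ?_
        refine mul_le_mul_of_nonneg_right ?_ (by linarith [hQ1 j])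
        exact mul_le_of_le_one_right (hQ0 i) (hA1 i j)
      have e2 : Q i * (n - n / 128) ≤ ∑ j, Q i * A i j := by
        rw [← Finset.mul_sum]
        simp only [hQ]
        split_ifs with c
        · rcases hdich i with e | e <;> linarith
        · simp
      have e3 : ∑ j, Q i * A i j = ∑ j, Q i * A i j * (1 - Q j) + ∑ j, Q i * A i j * Q j := by
        rw [← Finset.sum_add_distrib]; exact Finset.sum_congr rfl fun j _ => by ring
      linarith
    have := Finset.sum_le_sum fun i (_ : i ∈ Finset.univ) => hrow i
    rw [Finset.sum_sub_distrib, ← Finset.sum_mul, ← Finset.sum_mul, ← ha] at this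
    exact this
  have hbig : 1 / α ≤ n / 256 := by
    rw [div_le_iff₀ hα]
    have : α ^ 3 ≤ 1 / 8 := by
      calc α ^ 3 ≤ (1 / 2) ^ 3 := by gcongr
        _ = 1 / 8 := by norm_num
    have := mul_le_mul_of_nonneg_left this (mul_pos hn0 hα).le
    linarith
  have hl : (1 - α) / (2 * α) ≤ n / 512 := by
    have : (1 - α) / (2 * α) = (1 / α) / 2 - 1 / 2 := by field_simp
    linarith
  have hasmall : a ≤ 5 * n / 256 := by
    rcases ha0.eq_or_lt with e | e
    · rw [← e]; positivity
    · refine le_of_mul_le_mul_left ?_ e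
      have := mul_le_mul_of_nonneg_right hl ha0
      linarith
  have h2 : ∀ i j, i ≠ j → inner ℝ (v i) (v j) = α ∨ inner ℝ (v i) (v j) = -α :=
    fun i j hij => by
      rw [h.gram, if_neg hij]
      rcases h.entry i j with e | e <;> rw [e]
      · left; ring
      · right; ring
  obtain ⟨g1, g2⟩ := inner_smul_sign h.inner_self h2 (fun i => 1 - 2 * Q i) fun i => by
    rcases hQ01 i with e | e <;> rw [e] <;> norm_num
  obtain ⟨A', hA'⟩ := exists_equiangularGraph_of_inner _ g1 g2
  refine ⟨_, A', hA', fun i => ?_⟩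
  have hA1' : ∀ i j, A' i j ≤ 1 := fun i j => by rcases hA'.entry i j with e | e <;> simp [e]
  have hflip : ∀ j, Q j = 0 → i ≠ j → 1 - 2 * A' i j = (1 - 2 * Q i) * (1 - 2 * A i j) :=
    fun j hj hij => by
      have e := hA'.gram i j
      rw [if_neg hij, inner_smul_left, inner_smul_right, h.gram, if_neg hij, hj,
        conj_trivial] at e
      refine mul_left_cancel₀ hα.ne' ?_
      linarith
  have hterm : ∑ j, A' i j ≤ n / 128 + a := by
    by_cases c : n / 128 < ∑ j, A i j
    · have hQi : Q i = 1 := by simp [hQ, c]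
      have : ∀ j, A' i j ≤ (1 - A i j) + Q j := fun j => by
        rcases hQ01 j with e | e
        · have hij : i ≠ j := by rintro rfl; rw [hQi] at e; norm_num at e
          have := hflip j e hij
          rw [hQi] at this
          linarith
        · linarith [hA1' i j, hA1 i j]
      have := Finset.sum_le_sum fun j (_ : j ∈ Finset.univ) => this j
      rw [Finset.sum_add_distrib, Finset.sum_sub_distrib, ← ha] at this
      simp only [Finset.sum_const, Finset.card_univ, nsmul_eq_mul, ← hn_def, mul_one] at this
      rcases hdich i with e | e <;> linarith
    · have hQi : Q i = 0 := by simp [hQ, c]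
      have : ∀ j, A' i j ≤ A i j + Q j := fun j => by
        rcases hQ01 j with e | e
        · by_cases hij : i = j
          · subst hij; rw [hA'.diag, h.diag, e]; norm_num
          have := hflip j e hij
          rw [hQi] at this
          linarith
        · linarith [hA1' i j, h.nonneg i j]
      have := Finset.sum_le_sum fun j (_ : j ∈ Finset.univ) => this j
      rw [Finset.sum_add_distrib, ← ha] at this
      linarith
  linarith

end EquiangularGraph

theorem sum_weight_superset {ι : Type*} [Fintype ι] [DecidableEq ι] (q : ℝ) (S : Finset ι) :
    ∑ W : Finset ι, (if S ⊆ W then q ^ W.card * (1 - q) ^ Wᶜ.card else 0) = q ^ S.card := by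
  have key := Finset.prod_add (fun _ : ι => q) (fun k => if k ∈ S then 0 else 1 - q) Finset.univ
  have e1 : ∏ i : ι, (q + if i ∈ S then 0 else 1 - q) = q ^ S.card := by
    have : ∀ i, (q + if i ∈ S then 0 else 1 - q) = if i ∈ S then q else 1 := fun i => by
      split_ifs <;> ring
    simp only [this, Finset.prod_ite_mem, Finset.univ_inter, Finset.prod_const]
  rw [e1, Finset.powerset_univ] at key
  rw [key]
  refine Finset.sum_congr rfl fun W _ => ?_
  rw [Finset.prod_const, ← Finset.compl_eq_univ_sdiff]
  split_ifs with hS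
  · congr 1
    rw [← Finset.prod_const]
    refine Finset.prod_congr rfl fun i hi => ?_
    rw [if_neg fun h => Finset.mem_compl.1 hi (hS h)]
  · obtain ⟨i, hi, hiW⟩ := Finset.not_subset.1 hS
    rw [Finset.prod_eq_zero (Finset.mem_compl.2 hiW) (by simp [hi]), mul_zero]

theorem sum_weight_mul_card_compl {ι : Type*} [Fintype ι] [DecidableEq ι] (q : ℝ) :
    ∑ W : Finset ι, q ^ W.card * (1 - q) ^ Wᶜ.card * (Wᶜ.card : ℝ) =
      (1 - q) * Fintype.card ι := by
  have h1 := sum_weight_superset q (∅ : Finset ι)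
  simp only [Finset.empty_subset, if_true, Finset.card_empty, pow_zero] at h1
  have h2 : ∀ i : ι, ∑ W : Finset ι, (if i ∈ W then q ^ W.card * (1 - q) ^ Wᶜ.card else 0) = q :=
    fun i => by
      have := sum_weight_superset q ({i} : Finset ι)
      simpa using this
  have h3 : ∀ W : Finset ι, q ^ W.card * (1 - q) ^ Wᶜ.card * (Wᶜ.card : ℝ) =
      Fintype.card ι * (q ^ W.card * (1 - q) ^ Wᶜ.card) -
        ∑ i : ι, (if i ∈ W then q ^ W.card * (1 - q) ^ Wᶜ.card else 0) := fun W => by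
    have : (W.card : ℝ) + Wᶜ.card = Fintype.card ι := by
      exact_mod_cast Finset.card_add_card_compl W
    rw [Finset.sum_ite_mem, Finset.univ_inter, Finset.sum_const, nsmul_eq_mul]
    linear_combination (q ^ W.card * (1 - q) ^ Wᶜ.card) * this
  simp only [h3, Finset.sum_sub_distrib, ← Finset.mul_sum, h1]
  rw [Finset.sum_comm]
  simp only [h2, Finset.sum_const, Finset.card_univ, nsmul_eq_mul]
  ring

/-- The principal part of a matrix supported on a set of indices. -/
noncomputable def Matrix.restrictTo {ι : Type*} [DecidableEq ι] (A : Matrix ι ι ℝ)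
    (W : Finset ι) : Matrix ι ι ℝ :=
  Matrix.of fun i j => if i ∈ W ∧ j ∈ W then A i j else 0

/-- The expected number of walks of length `k` from `x` to `y` that survive in a random set of
indices containing `S`; walks are separated according to whether they visit `T` vertices. -/
theorem sum_weight_walks_le {ι : Type*} [Fintype ι] [DecidableEq ι] (A : Matrix ι ι ℝ)
    (hA0 : ∀ i j, 0 ≤ A i j) (hA1 : ∀ i j, A i j ≤ 1) {Δ : ℝ} (hΔ : 1 ≤ Δ)
    (hdeg : ∀ i, ∑ j, A i j ≤ Δ) {q : ℝ} (hq0 : 0 ≤ q) (hq1 : q ≤ 1) (T : ℕ) (k : ℕ) :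
    ∀ (S : Finset ι) (x y : ι), x ∈ S →
      ∑ W : Finset ι, (if S ⊆ W then
          q ^ W.card * (1 - q) ^ Wᶜ.card * (A.restrictTo W ^ k) x y else 0) ≤
        q ^ T * (A ^ k) x y + if S.card < T then (T : ℝ) ^ k * Δ ^ (T - S.card) else 0 := by
  induction k with
  | zero =>
    intro S x y _
    have hs : ∑ W : Finset ι, (if S ⊆ W then
        q ^ W.card * (1 - q) ^ Wᶜ.card * (A.restrictTo W ^ 0) x y else 0) =
        q ^ S.card * (1 : Matrix ι ι ℝ) x y := by
      rw [← sum_weight_superset q S, Finset.sum_mul]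
      exact Finset.sum_congr rfl fun W _ => by rw [pow_zero, ite_zero_mul]
    rw [hs, pow_zero, pow_zero, one_mul]
    have h01 : 0 ≤ (1 : Matrix ι ι ℝ) x y ∧ (1 : Matrix ι ι ℝ) x y ≤ 1 := by
      rw [Matrix.one_apply]; split_ifs <;> norm_num
    split_ifs with h
    · have h1 : q ^ S.card ≤ 1 := pow_le_one₀ hq0 hq1
      have h2 : 1 ≤ Δ ^ (T - S.card) := one_le_pow₀ hΔ
      have h3 : 0 ≤ q ^ T * (1 : Matrix ι ι ℝ) x y := mul_nonneg (pow_nonneg hq0 _) h01.1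
      have h4 := mul_le_mul h1 h01.2 h01.1 zero_le_one
      linarith
    · rw [add_zero]
      exact mul_le_mul_of_nonneg_right (pow_le_pow_of_le_one hq0 hq1 (not_lt.1 h)) h01.1
  | succ k ih =>
    intro S x y hx
    have hstep : ∀ W : Finset ι, (if S ⊆ W then
        q ^ W.card * (1 - q) ^ Wᶜ.card * (A.restrictTo W ^ (k + 1)) x y else 0) =
        ∑ u, A x u * (if insert u S ⊆ W then
          q ^ W.card * (1 - q) ^ Wᶜ.card * (A.restrictTo W ^ k) u y else 0) := fun W => by
      by_cases hS : S ⊆ W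
      · rw [if_pos hS, pow_succ', Matrix.mul_apply, Finset.mul_sum]
        refine Finset.sum_congr rfl fun u _ => ?_
        simp only [Matrix.restrictTo, Matrix.of_apply, hS hx, true_and, Finset.insert_subset_iff,
          hS, and_true]
        split_ifs <;> ring
      · have : ∀ u, ¬ insert u S ⊆ W := fun u hu => hS ((Finset.subset_insert u S).trans hu)
        simp [hS, this]
    simp only [hstep]
    rw [Finset.sum_comm]
    simp only [← Finset.mul_sum]
    have h1 : ∀ u, A x u * (∑ W : Finset ι, if insert u S ⊆ W then
        q ^ W.card * (1 - q) ^ Wᶜ.card * (A.restrictTo W ^ k) u y else 0) ≤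
        q ^ T * (A x u * (A ^ k) u y) + A x u * (if (insert u S).card < T then
          (T : ℝ) ^ k * Δ ^ (T - (insert u S).card) else 0) := fun u => by
      have := mul_le_mul_of_nonneg_left (ih (insert u S) u y (Finset.mem_insert_self u S)) (hA0 x u)
      linarith
    refine (Finset.sum_le_sum fun u _ => h1 u).trans ?_
    rw [Finset.sum_add_distrib, ← Finset.mul_sum, pow_succ' A, Matrix.mul_apply]
    refine add_le_add_right ?_ _
    by_cases hT : S.card < T
    · rw [if_pos hT]
      set C := (T : ℝ) ^ k * Δ ^ (T - S.card) with hC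
      have hC0 : 0 ≤ C := by positivity
      have h2 : ∀ u, A x u * (if (insert u S).card < T then
          (T : ℝ) ^ k * Δ ^ (T - (insert u S).card) else 0) ≤
          (if u ∈ S then C else 0) + A x u * (C / Δ) := fun u => by
        have hΔ0 : 0 < Δ := by linarith
        have hr : 0 ≤ A x u * (C / Δ) := mul_nonneg (hA0 x u) (by positivity)
        by_cases hu : u ∈ S
        · rw [Finset.insert_eq_of_mem hu, if_pos hT, if_pos hu]
          have := mul_le_of_le_one_left hC0 (hA1 x u)
          linarith
        · rw [Finset.card_insert_of_notMem hu, if_neg hu, zero_add]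
          refine mul_le_mul_of_nonneg_left ?_ (hA0 x u)
          split_ifs with h3
          · rw [hC, le_div_iff₀ hΔ0, mul_assoc, ← pow_succ,
              show T - (S.card + 1) + 1 = T - S.card by omega]
          · positivity
      refine (Finset.sum_le_sum fun u _ => h2 u).trans ?_
      rw [Finset.sum_add_distrib, Finset.sum_ite_mem, Finset.univ_inter, Finset.sum_const,
        nsmul_eq_mul, ← Finset.sum_mul]
      have h3 : (∑ i, A x i) * (C / Δ) ≤ C := by
        have := mul_le_mul_of_nonneg_right (hdeg x) (show 0 ≤ C / Δ by positivity)
        rwa [mul_div_cancel₀ C (by linarith : Δ ≠ 0)] at this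
      have h4 : (S.card : ℝ) + 1 ≤ T := by exact_mod_cast hT
      have h5 := mul_le_mul_of_nonneg_right h4 hC0
      have h6 : (T : ℝ) ^ (k + 1) * Δ ^ (T - S.card) = T * C := by rw [hC]; ring
      rw [h6]
      linarith
    · rw [if_neg hT]
      refine (Finset.sum_eq_zero fun u _ => ?_).le
      have : ¬ (insert u S).card < T := by
        have := Finset.card_le_card (Finset.subset_insert u S)
        omega
      rw [if_neg this, mul_zero]

theorem finrank_mul_pow_le_trace {ι : Type*} [Fintype ι] [DecidableEq ι] (H : Matrix ι ι ℝ)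
    (hH : H.IsSymm) (K : Submodule ℝ (EuclideanSpace ℝ ι)) (l : ℝ)
    (hK : ∀ x ∈ K, H.mulVec x.ofLp = l • x.ofLp) (s : ℕ) :
    (Module.finrank ℝ K : ℝ) * l ^ (2 * s) ≤ (H ^ (2 * s)).trace := by
  let b := stdOrthonormalBasis ℝ K
  have hb : Orthonormal ℝ (fun j => (b j : EuclideanSpace ℝ ι)) :=
    b.orthonormal.comp_linearIsometry K.subtypeₗᵢ
  have hpow : ∀ x ∈ K, (H ^ s).mulVec x.ofLp = l ^ s • x.ofLp := fun x hx => by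
    induction s with
    | zero => simp
    | succ s ih =>
      rw [pow_succ, ← Matrix.mulVec_mulVec, hK x hx, Matrix.mulVec_smul, ih, smul_smul, pow_succ,
        mul_comm]
  have hs : (H ^ s).IsSymm := hH.pow s
  let c : ι → EuclideanSpace ℝ ι := fun i => WithLp.toLp 2 fun k => (H ^ s) i k
  have hbessel : ∀ i, ∑ j, inner ℝ (b j : EuclideanSpace ℝ ι) (c i) ^ 2 ≤ ‖c i‖ ^ 2 := fun i => by
    have := hb.sum_inner_products_le (c i) (s := Finset.univ)
    simpa using this
  have hin : ∀ i j, inner ℝ (b j : EuclideanSpace ℝ ι) (c i) =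
      l ^ s * (b j : EuclideanSpace ℝ ι) i := fun i j => by
    have := congrFun (hpow (b j) (b j).2) i
    rw [Matrix.mulVec, dotProduct] at this
    simp only [PiLp.inner_apply, RCLike.inner_apply, conj_trivial, c]
    rw [this]; simp
  have hsum := Finset.sum_le_sum fun i (_ : i ∈ Finset.univ) => hbessel i
  have hl : ∑ i, ∑ j, inner ℝ (b j : EuclideanSpace ℝ ι) (c i) ^ 2 =
      (Module.finrank ℝ K : ℝ) * l ^ (2 * s) := by
    rw [Finset.sum_comm]
    have : ∀ j, ∑ i, inner ℝ (b j : EuclideanSpace ℝ ι) (c i) ^ 2 = l ^ (2 * s) := fun j => by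
      simp only [hin, mul_pow, ← Finset.mul_sum]
      rw [← EuclideanSpace.real_norm_sq_eq, hb.1 j]
      ring
    simp [this]
  have hr : ∑ i, ‖c i‖ ^ 2 = (H ^ (2 * s)).trace := by
    rw [two_mul, pow_add, Matrix.trace]
    refine Finset.sum_congr rfl fun i _ => ?_
    rw [EuclideanSpace.real_norm_sq_eq, Matrix.diag_apply, Matrix.mul_apply]
    refine Finset.sum_congr rfl fun j _ => ?_
    rw [hs.apply i j]; simp [c, sq]
  rw [hl, hr] at hsum
  exact hsum

namespace EquiangularGraph

variable {ι : Type*} [Fintype ι] [DecidableEq ι] {r : ℕ} {α : ℝ}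
  {v : ι → EuclideanSpace ℝ (Fin r)} {A : Matrix ι ι ℝ}

theorem multiplicity_le (h : EquiangularGraph α v A) (hα : 0 < α) (hα1 : α ≤ 1)
    (W : Finset ι) (s : ℕ) :
    ((Fintype.card ι : ℝ) - r - 1 - Wᶜ.card) * ((1 - α) / (2 * α)) ^ (2 * s) ≤
      (A.restrictTo W ^ (2 * s)).trace := by
  set l := (1 - α) / (2 * α) with hl
  have hl0 : 0 ≤ l := div_nonneg (by linarith) (by linarith)
  let f : (ι → ℝ) →ₗ[ℝ] EuclideanSpace ℝ (Fin r) × ℝ × ({i // i ∈ Wᶜ} → ℝ) :=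
    (Fintype.linearCombination ℝ v).prod
      ((Fintype.linearCombination ℝ (fun _ => (1 : ℝ))).prod
        (LinearMap.funLeft ℝ ℝ Subtype.val))
  let g := f.comp (WithLp.linearEquiv 2 ℝ (ι → ℝ)).toLinearMap
  have hdim : (Fintype.card ι : ℝ) - r - 1 - Wᶜ.card ≤ Module.finrank ℝ (LinearMap.ker g) := by
    have h1 := LinearMap.finrank_range_add_finrank_ker g
    have h2 := Submodule.finrank_le (LinearMap.range g)
    rw [Module.finrank_prod, Module.finrank_prod] at h2
    simp only [finrank_euclideanSpace, Fintype.card_fin, Module.finrank_self,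
      Module.finrank_fintype_fun_eq_card, Fintype.card_coe] at h1 h2
    have h3 : Fintype.card ι ≤ r + (1 + Wᶜ.card) + Module.finrank ℝ (LinearMap.ker g) := by omega
    have h4 : (Fintype.card ι : ℝ) ≤
        r + (1 + Wᶜ.card) + Module.finrank ℝ (LinearMap.ker g) := by exact_mod_cast h3
    linarith
  have hsymm : (A.restrictTo W).IsSymm := by
    ext i j
    simp only [Matrix.restrictTo, Matrix.transpose_apply, Matrix.of_apply, h.symm j i, and_comm]
  refine (mul_le_mul_of_nonneg_right hdim (pow_nonneg hl0 _)).trans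
    (finrank_mul_pow_le_trace _ hsymm _ l (fun x hx => ?_) s)
  have hx1 : ∑ j, x j • v j = 0 := congrArg Prod.fst (LinearMap.mem_ker.1 hx)
  have hx2 : ∑ j, x j = 0 := by
    have : ∑ j, x j • (1 : ℝ) = 0 := congrArg (fun p => p.2.1) (LinearMap.mem_ker.1 hx)
    simpa using this
  have hx3 : ∀ i, i ∉ W → x i = 0 := fun i hi =>
    congrFun (congrArg (fun p => p.2.2) (LinearMap.mem_ker.1 hx)) ⟨i, Finset.mem_compl.2 hi⟩
  ext i
  rw [Matrix.mulVec, dotProduct]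
  simp only [Matrix.restrictTo, Matrix.of_apply, Pi.smul_apply, smul_eq_mul]
  by_cases hi : i ∈ W
  · have e : ∀ j, (if i ∈ W ∧ j ∈ W then A i j else 0) * x j = A i j * x j := fun j => by
      by_cases hj : j ∈ W
      · simp [hi, hj]
      · simp [hx3 j hj]
    simp only [e]
    have := h.inner_sum_smul x.ofLp i
    rw [hx1, hx2, inner_zero_right] at this
    rw [hl, div_mul_eq_mul_div, eq_div_iff (by positivity)]
    linarith
  · simp [hi, hx3 i hi]

end EquiangularGraph

namespace EquiangularGraph

variable {ι : Type*} [Fintype ι] [DecidableEq ι] {r : ℕ} {α : ℝ}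
  {v : ι → EuclideanSpace ℝ (Fin r)} {A : Matrix ι ι ℝ}

/-- The quadratic form of `A` on vectors with small support. -/
theorem abs_quadratic_le (h : EquiangularGraph α v A) (hα : 0 < α) (hα1 : α ≤ 1) {Δ : ℝ}
    (hdeg : ∀ i, ∑ j, A i j ≤ Δ) (z : ι → ℝ) (Z : Finset ι) (hZ : ∀ i, i ∉ Z → z i = 0)
    {M : ℝ} (hM : Z.card ≤ M) :
    |∑ i, ∑ j, z i * A i j * z j| ≤
      ((1 - α) / (2 * α) + 2 * Δ * M / Fintype.card ι) * ∑ i, z i ^ 2 := by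
  rcases isEmpty_or_nonempty ι with hι | ⟨⟨i₁⟩⟩
  · simp
  have : Nonempty ι := ⟨i₁⟩
  have hΔ : 0 ≤ Δ := (Finset.sum_nonneg fun j _ => h.nonneg i₁ j).trans (hdeg i₁)
  set n : ℝ := ((Fintype.card ι : ℕ) : ℝ) with hn_def
  have hn : 0 < n := by rw [hn_def]; exact_mod_cast Fintype.card_pos
  set l := (1 - α) / (2 * α) with hl
  have hl0 : 0 ≤ l := div_nonneg (by linarith) (by linarith)
  have h1 : |∑ i, ∑ j, z i * A i j * z j| ≤ ∑ i, ∑ j, |z i| * A i j * |z j| := by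
    refine (Finset.abs_sum_le_sum_abs _ _).trans (Finset.sum_le_sum fun i _ => ?_)
    refine (Finset.abs_sum_le_sum_abs _ _).trans (Finset.sum_le_sum fun j _ => ?_)
    rw [abs_mul, abs_mul, abs_of_nonneg (h.nonneg i j)]
  set S := ∑ i, |z i| with hS
  have key := h.quadratic_sub_const_le hα (fun i => |z i|) (S / n)
    (by rw [← hn_def, div_mul_cancel₀ _ hn.ne'])
  simp only [sq_abs, ← hl, ← hn_def] at key
  have h2 : ∑ i, |z i| * ∑ j, A i j ≤ S * Δ := by
    rw [hS, Finset.sum_mul]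
    exact Finset.sum_le_sum fun i _ => mul_le_mul_of_nonneg_left (hdeg i) (abs_nonneg _)
  have h3 : S ^ 2 ≤ M * ∑ i, z i ^ 2 := by
    have e1 : S = ∑ i ∈ Z, |z i| :=
      (Finset.sum_subset (Finset.subset_univ Z) fun i _ hi => by simp [hZ i hi]).symm
    have e2 : ∑ i ∈ Z, |z i| ^ 2 ≤ ∑ i, z i ^ 2 := by
      simp only [sq_abs]
      exact Finset.sum_le_univ_sum_of_nonneg fun i => sq_nonneg _
    have e3 : (0 : ℝ) ≤ M := (Nat.cast_nonneg _).trans hM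
    rw [e1]
    exact sq_sum_le_card_mul_sum_sq.trans (mul_le_mul hM e2
      (Finset.sum_nonneg fun i _ => sq_nonneg _) e3)
  have hS0 : 0 ≤ S := Finset.sum_nonneg fun i _ => abs_nonneg _
  have h4 : 0 ≤ (S / n) ^ 2 * ∑ i, ∑ j, A i j := mul_nonneg (sq_nonneg _)
    (Finset.sum_nonneg fun i _ => Finset.sum_nonneg fun j _ => h.nonneg i j)
  have h5 : 0 ≤ l * ((S / n) ^ 2 * n) := by positivity
  have h6 : 2 * (S / n) * ∑ i, |z i| * ∑ j, A i j ≤ 2 * Δ * M / n * ∑ i, z i ^ 2 := by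
    calc 2 * (S / n) * ∑ i, |z i| * ∑ j, A i j ≤ 2 * (S / n) * (S * Δ) := by gcongr
      _ = 2 * Δ / n * S ^ 2 := by ring
      _ ≤ 2 * Δ / n * (M * ∑ i, z i ^ 2) := by gcongr
      _ = _ := by ring
  linarith

theorem card_support_pow_le (h : EquiangularGraph α v A) {Δ : ℝ}
    (hdeg : ∀ i, ∑ j, A i j ≤ Δ) (x : ι) (k : ℕ) :
    ∃ Z : Finset ι, (Z.card : ℝ) ≤ Δ ^ k ∧ ∀ i, i ∉ Z → (A ^ k) i x = 0 := by
  classical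
  have hΔ : 0 ≤ Δ := (Finset.sum_nonneg fun j _ => h.nonneg x j).trans (hdeg x)
  induction k with
  | zero =>
    refine ⟨{x}, by simp, fun i hi => ?_⟩
    rw [pow_zero, Matrix.one_apply_ne (by simpa using hi)]
  | succ k ih =>
    obtain ⟨Z, hZ, hZ'⟩ := ih
    refine ⟨Z.biUnion fun j => {i | A j i = 1}, ?_, fun i hi => ?_⟩
    · have h1 : ((Z.biUnion fun j => ({i | A j i = 1} : Finset ι)).card : ℝ) ≤
          ∑ j ∈ Z, (({i | A j i = 1} : Finset ι).card : ℝ) := by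
        exact_mod_cast Finset.card_biUnion_le
      have h2 : ∀ j, (({i | A j i = 1} : Finset ι).card : ℝ) = ∑ i, A j i := fun j => by
        rw [Finset.card_filter]
        push_cast
        refine Finset.sum_congr rfl fun i _ => ?_
        rcases h.entry j i with e | e <;> simp [e]
      simp only [h2] at h1
      refine h1.trans ((Finset.sum_le_sum fun j _ => hdeg j).trans ?_)
      rw [Finset.sum_const, nsmul_eq_mul, pow_succ]
      exact mul_le_mul_of_nonneg_right hZ hΔ
    · rw [pow_succ', Matrix.mul_apply]
      refine Finset.sum_eq_zero fun j _ => ?_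
      by_cases hj : j ∈ Z
      · rcases h.entry j i with e | e
        · rw [h.symm, e, zero_mul]
        · exact absurd (Finset.mem_biUnion.2 ⟨j, hj, by simpa using e⟩) hi
      · rw [hZ' j hj, mul_zero]

/-- The number of closed walks of length `2 s` is controlled by the second eigenvalue. -/
theorem closed_walks_le (h : EquiangularGraph α v A) (hα : 0 < α) (hα1 : α < 1) {Δ : ℝ}
    (hΔ : 1 ≤ Δ) (hdeg : ∀ i, ∑ j, A i j ≤ Δ) (x : ι) (s : ℕ) :
    (A ^ (2 * s)) x x ≤
      ((1 - α) / (2 * α) + 4 * Δ ^ (s + 1) / Fintype.card ι) ^ (2 * s) := by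
  set n : ℝ := ((Fintype.card ι : ℕ) : ℝ) with hn_def
  set m := (1 - α) / (2 * α) + 4 * Δ ^ (s + 1) / n with hm
  have hm0 : 0 < m := by
    have : 0 < (1 - α) / (2 * α) := div_pos (by linarith) (by linarith)
    positivity
  have hAs : A.IsSymm := by ext i j; exact h.symm j i
  have hstep : ∀ k, k + 1 ≤ s →
      ∑ i, (A ^ (k + 1)) i x ^ 2 ≤ m ^ 2 * ∑ i, (A ^ k) i x ^ 2 := by
    intro k hk
    obtain ⟨Z₁, hZ₁, hZ₁'⟩ := h.card_support_pow_le hdeg x k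
    obtain ⟨Z₂, hZ₂, hZ₂'⟩ := h.card_support_pow_le hdeg x (k + 1)
    have hcard : ((Z₁ ∪ Z₂).card : ℝ) ≤ 2 * Δ ^ s := by
      have h1 : ((Z₁ ∪ Z₂).card : ℝ) ≤ Z₁.card + Z₂.card := by
        exact_mod_cast Finset.card_union_le Z₁ Z₂
      have h2 : Δ ^ k ≤ Δ ^ s := pow_le_pow_right₀ hΔ (by omega)
      have h3 : Δ ^ (k + 1) ≤ Δ ^ s := pow_le_pow_right₀ hΔ hk
      linarith
    have hq : ∀ c : ℝ, |∑ i, ∑ j, ((A ^ k) i x + c * (A ^ (k + 1)) i x) * A i j *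
        ((A ^ k) j x + c * (A ^ (k + 1)) j x)| ≤
        m * ∑ i, ((A ^ k) i x + c * (A ^ (k + 1)) i x) ^ 2 := fun c => by
      have := h.abs_quadratic_le hα hα1.le hdeg
        (fun i => (A ^ k) i x + c * (A ^ (k + 1)) i x) (Z₁ ∪ Z₂) (fun i hi => by
          rw [Finset.mem_union, not_or] at hi
          simp only [hZ₁' i hi.1, hZ₂' i hi.2, mul_zero, add_zero]) hcard
      refine this.trans (le_of_eq ?_)
      rw [hm, ← hn_def, pow_succ]
      ring
    set X := ∑ i, (A ^ k) i x ^ 2 with hX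
    set Y := ∑ i, (A ^ (k + 1)) i x ^ 2 with hY
    have hmul : ∀ i, ∑ j, A i j * (A ^ k) j x = (A ^ (k + 1)) i x := fun i => by
      rw [pow_succ', Matrix.mul_apply]
    set P := ∑ i, (A ^ k) i x * (A ^ (k + 1)) i x with hP
    set R := ∑ i, (A ^ (k + 1)) i x * ∑ j, A i j * (A ^ (k + 1)) j x with hR
    have hexp : ∀ c : ℝ, ∑ i, ∑ j, ((A ^ k) i x + c * (A ^ (k + 1)) i x) * A i j *
        ((A ^ k) j x + c * (A ^ (k + 1)) j x) = P + 2 * c * Y + c ^ 2 * R := fun c => by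
      have e1 : ∑ i, (A ^ k) i x * ∑ j, A i j * (A ^ (k + 1)) j x = Y := by
        simp only [Finset.mul_sum]
        rw [Finset.sum_comm, hY]
        refine Finset.sum_congr rfl fun j _ => ?_
        rw [sq, ← hmul j, Finset.sum_mul]
        exact Finset.sum_congr rfl fun i _ => by rw [hmul j, h.symm j i]; ring
      have e2 : ∑ i, (A ^ (k + 1)) i x * ∑ j, A i j * (A ^ k) j x = Y := by
        simp only [hmul, hY, sq]
      have e3 : ∑ i, (A ^ k) i x * ∑ j, A i j * (A ^ k) j x = P := by simp only [hmul, hP]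
      rw [← e3, two_mul, add_mul, hR]
      nth_rewrite 1 [← e1]
      rw [← e2]
      simp only [Finset.mul_sum, ← Finset.sum_add_distrib]
      exact Finset.sum_congr rfl fun i _ => Finset.sum_congr rfl fun j _ => by ring
    have hsq : ∀ c : ℝ, ∑ i, ((A ^ k) i x + c * (A ^ (k + 1)) i x) ^ 2 =
        X + 2 * c * P + c ^ 2 * Y := fun c => by
      rw [hX, hP, hY]
      simp only [Finset.mul_sum, ← Finset.sum_add_distrib]
      exact Finset.sum_congr rfl fun i _ => by ring
    have q1 := (abs_le.1 (hq (1 / m))).2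
    have q2 := (abs_le.1 (hq (-(1 / m)))).1
    rw [hexp, hsq] at q1 q2
    have e4 : m * (1 / m) = 1 := mul_one_div_cancel hm0.ne'
    have e5 : 2 * (1 / m) * Y ≤ m * (X + (1 / m) ^ 2 * Y) := by linarith
    have e6 := mul_le_mul_of_nonneg_left e5 hm0.le
    have e7 : m * (2 * (1 / m) * Y) = 2 * Y := by field_simp
    have e8 : m * (m * (X + (1 / m) ^ 2 * Y)) = m ^ 2 * X + Y := by field_simp
    rw [e7, e8] at e6
    linarith
  have hall : ∀ k, k ≤ s → ∑ i, (A ^ k) i x ^ 2 ≤ m ^ (2 * k) := by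
    intro k
    induction k with
    | zero =>
      intro _
      simp [Matrix.one_apply]
    | succ k ih =>
      intro hk
      have := mul_le_mul_of_nonneg_left (ih (by omega)) (sq_nonneg m)
      refine (hstep k hk).trans (this.trans (le_of_eq ?_))
      rw [← pow_add]; congr 1; ring
  refine le_trans (le_of_eq ?_) (hall s le_rfl)
  rw [two_mul, pow_add, Matrix.mul_apply]
  refine Finset.sum_congr rfl fun i _ => ?_
  rw [sq, (hAs.pow s).apply i x]

/-- Bound for the multiplicity of the second eigenvalue. -/
theorem card_sub_le (h : EquiangularGraph α v A) (hα : 0 < α) (hα1 : α < 1) {Δ : ℝ}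
    (hΔ : 1 ≤ Δ) (hdeg : ∀ i, ∑ j, A i j ≤ Δ) {q : ℝ} (hq0 : 0 ≤ q) (hq1 : q ≤ 1)
    {s : ℕ} (hs : 1 ≤ s) (T : ℕ) {l : ℝ} (hl : l = (1 - α) / (2 * α)) :
    (Fintype.card ι : ℝ) - r - 1 ≤ Fintype.card ι * ((1 - q) +
      q ^ T * (1 + 4 * Δ ^ (s + 1) / (Fintype.card ι * l)) ^ (2 * s) +
      (T / l) ^ (2 * s) * Δ ^ T) := by
  have hl0 : 0 < l := hl ▸ div_pos (by linarith) (by linarith)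
  set n : ℝ := ((Fintype.card ι : ℕ) : ℝ) with hn_def
  have hA1 : ∀ i j, A i j ≤ 1 := fun i j => by rcases h.entry i j with e | e <;> simp [e]
  set wt : Finset ι → ℝ := fun W => q ^ W.card * (1 - q) ^ Wᶜ.card with hwt
  have hwt0 : ∀ W, 0 ≤ wt W := fun W =>
    mul_nonneg (pow_nonneg hq0 _) (pow_nonneg (by linarith) _)
  have hw1 : ∑ W : Finset ι, wt W = 1 := by
    simpa using sum_weight_superset q (∅ : Finset ι)
  have hw2 : ∑ W : Finset ι, wt W * (Wᶜ.card : ℝ) = (1 - q) * n := sum_weight_mul_card_compl q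
  have htr : ∀ W : Finset ι, wt W * (A.restrictTo W ^ (2 * s)).trace =
      ∑ x, if {x} ⊆ W then wt W * (A.restrictTo W ^ (2 * s)) x x else 0 := fun W => by
    rw [Matrix.trace, Finset.mul_sum]
    refine Finset.sum_congr rfl fun x _ => ?_
    split_ifs with hx
    · rfl
    · obtain ⟨k, hk⟩ : ∃ k, 2 * s = k + 1 := ⟨2 * s - 1, by omega⟩
      rw [Matrix.diag_apply, hk, pow_succ', Matrix.mul_apply]
      rw [Finset.singleton_subset_iff] at hx
      simp [Matrix.restrictTo, hx]
  have hΔT : 0 ≤ (T : ℝ) ^ (2 * s) * Δ ^ T := by positivity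
  have hwalk : ∑ W : Finset ι, wt W * (A.restrictTo W ^ (2 * s)).trace ≤
      n * (q ^ T * (l + 4 * Δ ^ (s + 1) / n) ^ (2 * s) + (T : ℝ) ^ (2 * s) * Δ ^ T) := by
    simp only [htr]
    rw [Finset.sum_comm]
    have hx : ∀ x : ι, ∑ W : Finset ι,
        (if {x} ⊆ W then wt W * (A.restrictTo W ^ (2 * s)) x x else 0) ≤
        q ^ T * (l + 4 * Δ ^ (s + 1) / n) ^ (2 * s) + (T : ℝ) ^ (2 * s) * Δ ^ T := fun x => by
      refine (sum_weight_walks_le A h.nonneg hA1 hΔ hdeg hq0 hq1 T (2 * s) {x} x x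
        (Finset.mem_singleton_self x)).trans (add_le_add ?_ ?_)
      · rw [hl]
        exact mul_le_mul_of_nonneg_left (h.closed_walks_le hα hα1 hΔ hdeg x s) (pow_nonneg hq0 _)
      · split_ifs
        · exact mul_le_mul_of_nonneg_left (pow_le_pow_right₀ hΔ (Nat.sub_le _ _)) (by positivity)
        · exact hΔT
    refine (Finset.sum_le_sum fun x _ => hx x).trans (le_of_eq ?_)
    rw [Finset.sum_const, Finset.card_univ, nsmul_eq_mul]
  have hmult : ∑ W : Finset ι, wt W * ((n - r - 1 - Wᶜ.card) * l ^ (2 * s)) ≤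
      ∑ W : Finset ι, wt W * (A.restrictTo W ^ (2 * s)).trace :=
    Finset.sum_le_sum fun W _ => mul_le_mul_of_nonneg_left
      (hl ▸ h.multiplicity_le hα hα1.le W s) (hwt0 W)
  have hleft : ∑ W : Finset ι, wt W * ((n - r - 1 - Wᶜ.card) * l ^ (2 * s)) =
      (n - r - 1 - (1 - q) * n) * l ^ (2 * s) := by
    have : ∀ W : Finset ι, wt W * ((n - r - 1 - Wᶜ.card) * l ^ (2 * s)) =
      (n - r - 1) * l ^ (2 * s) * wt W - l ^ (2 * s) * (wt W * Wᶜ.card) := fun W => by ring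
    simp only [this, Finset.sum_sub_distrib, ← Finset.mul_sum, hw1, hw2]
    ring
  rw [hleft] at hmult
  have hfin := (le_div_iff₀ (pow_pos hl0 (2 * s))).2 (hmult.trans hwalk)
  have e1 : n * (q ^ T * (l + 4 * Δ ^ (s + 1) / n) ^ (2 * s) + (T : ℝ) ^ (2 * s) * Δ ^ T) /
      l ^ (2 * s) = n * (q ^ T * (1 + 4 * Δ ^ (s + 1) / (n * l)) ^ (2 * s) +
        (T / l) ^ (2 * s) * Δ ^ T) := by
    rw [show 1 + 4 * Δ ^ (s + 1) / (n * l) = (l + 4 * Δ ^ (s + 1) / n) / l by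
      rw [add_div, div_self hl0.ne', div_div], div_pow, div_pow]
    ring
  rw [e1] at hfin
  linarith

end EquiangularGraph

theorem logb_two_le_div_hundred {s : ℝ} (hs : 1024 ≤ s) : Real.logb 2 s ≤ s / 100 := by
  have h2 := Real.log_two_gt_d9
  have h1 : Real.log s = 10 * Real.log 2 + Real.log (s / 1024) := by
    rw [Real.log_div (by linarith) (by norm_num), show (1024 : ℝ) = 2 ^ 10 by norm_num,
      Real.log_pow]
    push_cast; ring
  have h3 := Real.log_le_sub_one_of_pos (show 0 < s / 1024 by linarith)
  rw [Real.logb, div_le_iff₀ (by linarith), h1]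
  nlinarith

theorem le_logb_two {x : ℝ} (k : ℕ) (h : (2 : ℝ) ^ k ≤ x) : (k : ℝ) ≤ Real.logb 2 x := by
  rw [Real.le_logb_iff_rpow_le (by norm_num) (lt_of_lt_of_le (by positivity) h),
    Real.rpow_natCast]
  exact h

theorem few_walks_numeric {l Δ : ℝ} {s T : ℕ} (hl : 16 ≤ l) (hs : 1024 ≤ s) (hT : 2 ≤ T)
    (hTl : (T : ℝ) ≤ l / 2) (hTs : (T : ℝ) * (5 * Real.logb 2 s) ≤ s) (hΔ0 : 0 ≤ Δ)
    (hΔ : Δ ≤ l ^ 4) : (T / l) ^ (2 * s) * Δ ^ T ≤ 1 / (2 * T) := by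
  have hs' : (1024 : ℝ) ≤ s := by exact_mod_cast hs
  have hT' : (2 : ℝ) ≤ T := by exact_mod_cast hT
  set y := Real.logb 2 s with hy
  set z := Real.logb 2 T with hz
  set X := Real.logb 2 l with hX
  have hy10 : 10 ≤ y := le_logb_two 10 (by norm_num; exact hs)
  have hys : y ≤ s / 100 := logb_two_le_div_hundred hs'
  have hX4 : 4 ≤ X := le_logb_two 4 (by norm_num; exact hl)
  have hz1 : 1 ≤ z := by
    have := le_logb_two (x := (T : ℝ)) 1 (by norm_num; exact hT)
    simpa using this
  have hTs50 : (T : ℝ) ≤ s / 50 := by nlinarith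
  have hzy : z ≤ y := Real.logb_le_logb_of_le (by norm_num) (by linarith) (by linarith)
  have hzX : z ≤ X - 1 := by
    have e : X - 1 = Real.logb 2 (l / 2) := by
      rw [Real.logb_div (by linarith) (by norm_num), Real.logb_self_eq_one (by norm_num)]
    rw [e]
    exact Real.logb_le_logb_of_le (by norm_num) (by linarith) hTl
  have hTz : (T : ℝ) = 2 ^ z := (Real.rpow_logb (by norm_num) (by norm_num) (by linarith)).symm
  have hlX : l = 2 ^ X := (Real.rpow_logb (by norm_num) (by norm_num) (by linarith)).symm
  have hexp : 2 * s * (z - X) + 4 * T * X ≤ -(1 + z) := by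
    rcases le_total (2 * z) X with hc | hc
    · have h1 : (T : ℝ) * X ≤ s / 50 * X := mul_le_mul_of_nonneg_right hTs50 (by linarith)
      have h2 : (s : ℝ) * (z - X) ≤ s * (-(X / 2)) :=
        mul_le_mul_of_nonneg_left (by linarith) (by linarith)
      have h3 : 1024 * X ≤ s * X := mul_le_mul_of_nonneg_right hs' (by linarith)
      linarith
    · have h1 : (T : ℝ) * X ≤ T * (2 * y) := mul_le_mul_of_nonneg_left (by linarith) (by linarith)
      have h2 : (s : ℝ) * (z - X) ≤ s * (-1) :=
        mul_le_mul_of_nonneg_left (by linarith) (by linarith)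
      linarith
  calc ((T : ℝ) / l) ^ (2 * s) * Δ ^ T ≤ (T / l) ^ (2 * s) * (l ^ 4) ^ T := by gcongr
    _ = 2 ^ (2 * s * (z - X) + 4 * T * X) := by
        nth_rewrite 1 [hTz]
        rw [hlX, ← Real.rpow_sub (by norm_num), ← pow_mul, ← Real.rpow_mul_natCast (by norm_num),
          ← Real.rpow_mul_natCast (by norm_num), ← Real.rpow_add (by norm_num)]
        push_cast; ring_nf
    _ ≤ 2 ^ (-(1 + z)) := Real.rpow_le_rpow_of_exponent_le (by norm_num) hexp
    _ = 1 / (2 * T) := by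
        rw [Real.rpow_neg (by norm_num), Real.rpow_add (by norm_num), Real.rpow_one, ← hTz,
          one_div]

/-- Choice of the length of the walks and of the number of visited vertices. -/
theorem exists_walk_parameters {α L : ℝ} (hα : 0 < α) (hα1 : α ≤ 1 / 51) (hL : 3300 ≤ L) :
    ∃ s T : ℕ, 1 ≤ s ∧ 2 ≤ T ∧ 3 * ((s : ℝ) + 1) ≤ L ∧ 3 * (T : ℝ) ≤ L ∧
      (T / ((1 - α) / (2 * α))) ^ (2 * s) * (1 / (4 * α ^ 3)) ^ T ≤ 1 / (2 * T) ∧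
      3 * (Real.logb 2 T + 3) / T < max (66 * (Real.logb 2 L) ^ 2 / L)
        (17 * α * Real.logb 2 (2 / α)) := by
  set l := (1 - α) / (2 * α) with hl
  have hl25 : 25 ≤ l := by rw [hl, le_div_iff₀ (by positivity)]; linarith
  have hl2 : l ≤ 1 / (2 * α) := by rw [hl]; gcongr; linarith
  obtain ⟨m, hm⟩ : ∃ m, ⌊L / 3⌋₊ = m + 2 := ⟨⌊L / 3⌋₊ - 2, by
    have : 2 ≤ ⌊L / 3⌋₊ := Nat.le_floor (by push_cast; linarith)
    omega⟩
  have hm1 : (m : ℝ) + 2 ≤ L / 3 := by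
    have := Nat.floor_le (show 0 ≤ L / 3 by linarith)
    rw [hm] at this; exact_mod_cast this
  have hm2 : L / 3 < (m : ℝ) + 3 := by
    have := Nat.lt_floor_add_one (L / 3)
    rw [hm] at this; push_cast at this; linarith
  have hm3 : (1024 : ℝ) ≤ m := by linarith
  set y := Real.logb 2 m with hy
  have hy10 : 10 ≤ y := le_logb_two 10 (by norm_num; exact_mod_cast hm3)
  have hym : y ≤ m / 100 := logb_two_le_div_hundred hm3
  have hm20 : 20 ≤ m / (5 * y) := by rw [le_div_iff₀ (by linarith)]; linarith
  set b := min (l / 2) (m / (5 * y)) with hb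
  have hb12 : 12 ≤ b := le_min (by linarith) (by linarith)
  set T := ⌊b⌋₊ with hT
  have hTb : (T : ℝ) ≤ b := Nat.floor_le (by linarith)
  have hTb' : b - 1 < T := by linarith [Nat.lt_floor_add_one b]
  have hT2 : 2 ≤ T := Nat.le_floor (by push_cast; linarith)
  have hTm : (T : ℝ) * (5 * y) ≤ m :=
    (le_div_iff₀ (by linarith)).1 (hTb.trans (min_le_right _ _))
  have hTl : (T : ℝ) ≤ l / 2 := hTb.trans (min_le_left _ _)
  have hT0 : (0 : ℝ) < T := by linarith
  have hTm50 : (T : ℝ) ≤ m / 50 := by nlinarith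
  refine ⟨m, T, by exact_mod_cast (by linarith : (1 : ℝ) ≤ m), hT2, by linarith, by linarith,
    few_walks_numeric (by linarith) (by exact_mod_cast hm3) hT2 hTl hTm (by positivity) ?_, ?_⟩
  · have h1 : 0.49 / α ≤ l := by
      rw [hl, div_le_div_iff₀ hα (by positivity)]; nlinarith
    calc 1 / (4 * α ^ 3) ≤ (0.49 / α) ^ 4 := by
          rw [div_pow, div_le_div_iff₀ (by positivity) (by positivity)]
          have := mul_le_mul_of_nonneg_right hα1 (pow_pos hα 3).le
          have h3 := pow_pos hα 3
          norm_num
          linarith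
      _ ≤ l ^ 4 := by gcongr
  · rw [div_lt_iff₀ hT0]
    have hα0 : 0 < 2 / α := by positivity
    rcases min_choice (l / 2) (m / (5 * y)) with hc | hc
    · refine lt_of_lt_of_le ?_ (mul_le_mul_of_nonneg_right (le_max_right _ _) hT0.le)
      rw [← hb] at hc
      have hz : Real.logb 2 T + 3 ≤ Real.logb 2 (2 / α) := by
        have e : Real.logb 2 (T * 8) = Real.logb 2 T + 3 := by
          rw [Real.logb_mul hT0.ne' (by norm_num), show (8 : ℝ) = 2 ^ 3 by norm_num,
            Real.logb_pow, Real.logb_self_eq_one (by norm_num)]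
          norm_num
        rw [← e]
        refine Real.logb_le_logb_of_le (by norm_num) (by positivity) ?_
        have : l / 2 * 8 ≤ 1 / (2 * α) / 2 * 8 := by gcongr
        have e2 : 1 / (2 * α) / 2 * 8 = 2 / α := by field_simp; norm_num
        linarith
      have hlog : 0 < Real.logb 2 (2 / α) := by
        refine Real.logb_pos (by norm_num) ?_
        rw [lt_div_iff₀ hα]; linarith
      have h3 : 3 < 17 * α * T := by
        have e : α * (l / 2) = (1 - α) / 4 := by rw [hl]; field_simp; norm_num
        have : α * (l / 2 - 1) < α * T := mul_lt_mul_of_pos_left (by linarith) hα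
        linarith
      have := mul_lt_mul_of_pos_right h3 hlog
      linarith
    · refine lt_of_lt_of_le ?_ (mul_le_mul_of_nonneg_right (le_max_left _ _) hT0.le)
      rw [← hb] at hc
      have hz : Real.logb 2 T + 3 ≤ y := by
        have e : Real.logb 2 (T * 8) = Real.logb 2 T + 3 := by
          rw [Real.logb_mul hT0.ne' (by norm_num), show (8 : ℝ) = 2 ^ 3 by norm_num,
            Real.logb_pow, Real.logb_self_eq_one (by norm_num)]
          norm_num
        rw [← e]
        exact Real.logb_le_logb_of_le (by norm_num) (by positivity) (by linarith)
      have hyx : y ≤ Real.logb 2 L :=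
        Real.logb_le_logb_of_le (by norm_num) (by linarith) (by linarith)
      have hT95 : 0.95 * (m / (5 * y)) ≤ T := by linarith
      have h4 : 0.95 * m ≤ 5 * y * T := by
        have e : 5 * y * (0.95 * (m / (5 * y))) = 0.95 * m := by field_simp
        have := mul_le_mul_of_nonneg_left hT95 (show 0 ≤ 5 * y by linarith)
        linarith
      have h5 : 0.33 * L ≤ m := by linarith
      have h6 : 3 * y * L < 66 * y ^ 2 * T := by
        have : y * (0.33 * 0.95 * L) ≤ y * (5 * y * T) :=
          mul_le_mul_of_nonneg_left (by linarith) (by linarith)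
        have hyL : 0 < y * L := mul_pos (by linarith) (by linarith)
        linarith
      have h7 : 66 * y ^ 2 * T ≤ 66 * Real.logb 2 L ^ 2 * T := by
        gcongr
      have hL0 : 0 < L := by linarith
      rw [div_mul_eq_mul_div, lt_div_iff₀ hL0]
      have := mul_le_mul_of_nonneg_right hz hL0.le
      linarith

theorem large_of_bound_lt_two {α L : ℝ} (hα : 0 < α) (hα1 : α ≤ 1 / 2) (hL : 4 ≤ L)
    (h1 : 66 * (Real.logb 2 L) ^ 2 / L < 2) (h2 : 17 * α * Real.logb 2 (2 / α) < 2) :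
    α ≤ 1 / 51 ∧ 3300 ≤ L := by
  have step1 : ∀ k : ℕ, (2 : ℝ) ^ k ≤ L → 33 * (k : ℝ) ^ 2 < L := fun k hk => by
    have hx := le_logb_two k hk
    rw [div_lt_iff₀ (by linarith)] at h1
    have := pow_le_pow_left₀ (Nat.cast_nonneg k) hx 2
    linarith
  have step2 : ∀ k : ℕ, (2 : ℝ) ^ k ≤ 2 / α → 17 * α * k < 2 := fun k hk =>
    lt_of_le_of_lt (mul_le_mul_of_nonneg_left (le_logb_two k hk) (by positivity)) h2
  constructor
  · have a1 := step2 2 (by rw [le_div_iff₀ hα]; norm_num; linarith)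
    norm_num at a1
    have a2 := step2 5 (by rw [le_div_iff₀ hα]; norm_num; linarith)
    norm_num at a2
    have a3 := step2 6 (by rw [le_div_iff₀ hα]; norm_num; linarith)
    norm_num at a3
    linarith
  · have a1 := step1 2 (by norm_num; linarith)
    norm_num at a1
    have a2 := step1 7 (by norm_num; linarith)
    norm_num at a2
    have a3 := step1 10 (by norm_num; linarith)
    norm_num at a3
    linarith

theorem one_sub_pow_le_inv {T : ℕ} (hT : 2 ≤ T) :
    0 ≤ 1 - Real.logb 2 T / T ∧ 0 ≤ Real.logb 2 T / T ∧
      (1 - Real.logb 2 T / T) ^ T ≤ 1 / T := by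
  have hT0 : (0 : ℝ) < T := by exact_mod_cast (by omega : 0 < T)
  have hT1 : (1 : ℝ) ≤ T := by exact_mod_cast (by omega : 1 ≤ T)
  have hz : Real.logb 2 T ≤ T := by
    rw [Real.logb_le_iff_le_rpow (by norm_num) hT0, Real.rpow_natCast]
    exact_mod_cast (Nat.lt_pow_self (by norm_num : 1 < 2)).le
  refine ⟨sub_nonneg.2 ((div_le_one hT0).2 hz),
    div_nonneg (Real.logb_nonneg (by norm_num) hT1) hT0.le, ?_⟩
  refine (Real.one_sub_div_pow_le_exp_neg hz).trans ?_
  rw [Real.exp_neg, ← one_div]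
  refine one_div_le_one_div_of_le hT0 ?_
  rw [← Real.log_le_iff_le_exp hT0, Real.logb, le_div_iff₀ (Real.log_pos (by norm_num))]
  have h1 : Real.log 2 ≤ 1 := by linarith [Real.log_two_lt_d9]
  exact mul_le_of_le_one_right (Real.log_nonneg hT1) h1

theorem surplus_factor_le_two {α L n l : ℝ} {s : ℕ} (hα : 0 < α) (hα1 : α ≤ 1)
    (hs : 3 * ((s : ℝ) + 1) ≤ L) (hn : (1 / α) ^ L ≤ n) (hl : 25 ≤ l) :
    (1 + 4 * (1 / (4 * α ^ 3)) ^ (s + 1) / (n * l)) ^ (2 * s) ≤ 2 := by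
  have hα' : 1 ≤ 1 / α := by rwa [le_div_iff₀ hα, one_mul]
  have hn0 : 0 < n := lt_of_lt_of_le (by positivity) hn
  have h1 : (1 / (4 * α ^ 3)) ^ (s + 1) ≤ (1 / 4) ^ (s + 1) * n := by
    have e : (1 / (4 * α ^ 3)) ^ (s + 1) = (1 / 4) ^ (s + 1) * (1 / α) ^ (3 * (s + 1)) := by
      rw [pow_mul, ← mul_pow]; congr 1; field_simp
    rw [e]
    refine mul_le_mul_of_nonneg_left (le_trans ?_ hn) (by positivity)
    rw [← Real.rpow_natCast]
    exact Real.rpow_le_rpow_of_exponent_le hα' (by push_cast; exact hs)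
  set w := 4 * (1 / (4 * α ^ 3)) ^ (s + 1) / (n * l) with hw
  have hw0 : 0 ≤ w := by positivity
  have hw1 : w ≤ (1 / 4) ^ s / 25 := by
    rw [hw, div_le_div_iff₀ (by positivity) (by norm_num)]
    have : (1 / 4 : ℝ) ^ s * (n * 25) ≤ (1 / 4) ^ s * (n * l) := by gcongr
    rw [pow_succ (1 / 4 : ℝ)] at h1
    linarith
  have hs4 : (s : ℝ) * (1 / 4) ^ s ≤ 1 := by
    rw [one_div, inv_pow, ← div_eq_mul_inv, div_le_one (by positivity)]
    exact_mod_cast (Nat.lt_pow_self (by norm_num : 1 < 4)).le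
  have h2 : (2 * s : ℕ) * w ≤ 1 / 2 := by
    push_cast
    have := mul_le_mul_of_nonneg_left hw1 (Nat.cast_nonneg (α := ℝ) s)
    linarith
  calc (1 + w) ^ (2 * s) ≤ (Real.exp w) ^ (2 * s) := by
        gcongr; linarith [Real.add_one_le_exp w]
    _ = Real.exp ((2 * s : ℕ) * w) := by rw [← Real.exp_nat_mul]
    _ ≤ Real.exp (1 / 2) := Real.exp_le_exp.2 h2
    _ ≤ 2 := by
        refine abs_le_of_sq_le_sq' ?_ (by norm_num) |>.2
        rw [← Real.exp_nat_mul]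
        have := Real.exp_one_lt_d9
        norm_num
        linarith

/-- The relative excess in the upper bound for the number of lines. -/
noncomputable def excessBound (α r : ℝ) : ℝ :=
  max (66 * (Real.logb 2 (Real.logb (1 / α) r)) ^ 2 / Real.logb (1 / α) r)
    (17 * α * Real.logb 2 (2 / α))

theorem excessBound_nonneg {α : ℝ} (hα : 0 < α) (hα1 : α < 1) (r : ℝ) : 0 ≤ excessBound α r := by
  refine le_max_of_le_right (mul_nonneg (by positivity) (Real.logb_nonneg (by norm_num) ?_))
  rw [le_div_iff₀ hα]; linarith

theorem card_le_of_inner {ι : Type*} [Fintype ι] {r : ℕ} {α : ℝ} (hα : 0 < α) (hα1 : α < 1)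
    (hr : 1 / α ^ 4 ≤ (r : ℝ)) (u : ι → EuclideanSpace ℝ (Fin r))
    (h1 : ∀ i, inner ℝ (u i) (u i) = 1)
    (h2 : ∀ i j, i ≠ j → inner ℝ (u i) (u j) = α ∨ inner ℝ (u i) (u j) = -α) :
    (Fintype.card ι : ℝ) ≤ r + r * excessBound α r := by
  classical
  by_contra hcon
  push Not at hcon
  have hε0 := excessBound_nonneg hα hα1 r
  have hr0 : (0 : ℝ) < r := lt_of_lt_of_le (by positivity) hr
  have hrn : (r : ℝ) < Fintype.card ι := by
    have := mul_nonneg hr0.le hε0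
    linarith
  have hι : Nonempty ι := by
    rw [← Fintype.card_pos_iff]; exact_mod_cast hr0.trans hrn
  obtain ⟨i₀⟩ := hι
  obtain ⟨v, A, h, h0⟩ := exists_equiangularGraph_of_base hα u h1 h2 i₀
  rcases lt_or_ge (1 / 2) α with hα2 | hα2
  · have := h.card_le_of_eq_zero hα hα1 (h.eq_zero_of_half_lt hα2 i₀ h0)
    have : (Fintype.card ι : ℝ) ≤ r := by exact_mod_cast this
    linarith
  set ε := excessBound α r with hε
  set L := Real.logb (1 / α) r with hL
  have hb1 : 1 < 1 / α := by rw [lt_div_iff₀ hα]; linarith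
  have hb2 : 2 ≤ 1 / α := by rw [le_div_iff₀ hα]; linarith
  have hrL : (1 / α) ^ L = r := Real.rpow_logb (by positivity) hb1.ne' hr0
  have hL4 : 4 ≤ L := by
    rw [hL, Real.le_logb_iff_rpow_le hb1 hr0]
    refine le_trans (le_of_eq ?_) hr
    rw [show (4 : ℝ) = ((4 : ℕ) : ℝ) by norm_num, Real.rpow_natCast, one_div_pow]
  have hε1 : 66 * (Real.logb 2 L) ^ 2 / L ≤ ε := le_max_left _ _
  have hε2 : 17 * α * Real.logb 2 (2 / α) ≤ ε := le_max_right _ _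
  have hsmall : ε < 2 → α ≤ 1 / 51 ∧ 3300 ≤ L := fun hlt =>
    large_of_bound_lt_two hα hα2 hL4 (hε1.trans_lt hlt) (hε2.trans_lt hlt)
  have hn : 32 / α ^ 4 ≤ Fintype.card ι := by
    have hα4 : 32 / α ^ 4 = 32 * (1 / α ^ 4) := by ring
    rw [hα4]
    have hrpow : ∀ k : ℕ, ((k + 4 : ℕ) : ℝ) ≤ L → 2 ^ k * (1 / α ^ 4) ≤ r := fun k hk => by
      calc (2 : ℝ) ^ k * (1 / α ^ 4) ≤ (1 / α) ^ k * (1 / α ^ 4) := by gcongr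
        _ = (1 / α) ^ ((k + 4 : ℕ) : ℝ) := by rw [Real.rpow_natCast, pow_add, one_div_pow α 4]
        _ ≤ (1 / α) ^ L := Real.rpow_le_rpow_of_exponent_le hb1.le hk
        _ = r := hrL
    rcases lt_or_ge L 8 with hL8 | hL8
    · have hx := le_logb_two (x := L) 2 (by norm_num; exact hL4)
      have : 33 ≤ ε := by
        refine le_trans ?_ hε1
        rw [le_div_iff₀ (by linarith)]
        have := pow_le_pow_left₀ (by norm_num) hx 2
        norm_num at this
        linarith
      have := mul_le_mul_of_nonneg_left this hr0.le
      linarith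
    · rcases lt_or_ge ε 2 with hlt | hge
      · have := hrpow 5 (by norm_num; linarith [(hsmall hlt).2])
        linarith
      · have h16 := hrpow 4 (by norm_num; exact hL8)
        have := mul_le_mul_of_nonneg_left hge hr0.le
        linarith
  obtain ⟨v', A', h', hd'⟩ := h.exists_small_degrees hα hα2 hn i₀ h0
  have h3 : (Fintype.card ι : ℝ) ≤ 3 * r := by
    exact_mod_cast h'.card_le_three_mul hα hα2 hn hd'
  rcases lt_or_ge ε 2 with hlt | hge
  swap
  · have := mul_le_mul_of_nonneg_left hge hr0.le
    linarith
  obtain ⟨hα51, hL3300⟩ := hsmall hlt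
  obtain ⟨s, T, hs, hT, hsL, hTL, hfew, hmain⟩ := exists_walk_parameters hα hα51 hL3300
  have hmain' : 3 * (Real.logb 2 T + 3) / T < ε := hmain
  obtain ⟨hq0, hq1, hqT⟩ := one_sub_pow_le_inv hT
  have hT0 : (0 : ℝ) < T := by exact_mod_cast (by omega : 0 < T)
  have hl25 : 25 ≤ (1 - α) / (2 * α) := by rw [le_div_iff₀ (by positivity)]; linarith
  have hΔ : 1 ≤ 1 / (4 * α ^ 3) := by
    rw [le_div_iff₀ (by positivity)]
    have : α ^ 3 ≤ (1 / 51) ^ 3 := by gcongr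
    norm_num at this
    linarith
  have key := h'.card_sub_le hα hα1 hΔ (fun i => h'.degree_le hα hα2 hn hd' i) hq0
    (by linarith) hs T rfl
  have hκ := surplus_factor_le_two hα hα1.le hsL (hrL.le.trans hrn.le) hl25
  set z := Real.logb 2 T with hz
  have hμ : (1 - (1 - z / T)) + (1 - z / T) ^ T *
      (1 + 4 * (1 / (4 * α ^ 3)) ^ (s + 1) / (Fintype.card ι * ((1 - α) / (2 * α)))) ^ (2 * s) +
      (T / ((1 - α) / (2 * α))) ^ (2 * s) * (1 / (4 * α ^ 3)) ^ T ≤ (z + 5 / 2) / T := by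
    have e1 := mul_le_mul hqT hκ (Even.pow_nonneg (even_two_mul s) _) (by positivity)
    have e2 : (z + 5 / 2) / T = z / T + 1 / T * 2 + 1 / (2 * T) := by field_simp; ring
    linarith
  have hz0 : 0 ≤ (z + 5 / 2) / T := by
    have := mul_nonneg hq1 hT0.le
    rw [div_mul_cancel₀ _ hT0.ne'] at this
    positivity
  have hfin : (Fintype.card ι : ℝ) - r - 1 ≤ 3 * r * ((z + 5 / 2) / T) :=
    key.trans ((mul_le_mul_of_nonneg_left hμ (Nat.cast_nonneg _)).trans
      (mul_le_mul_of_nonneg_right h3 hz0))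
  have hrε : r * (3 * (z + 3) / T) < r * ε := mul_lt_mul_of_pos_left hmain' hr0
  have hTr : (r : ℝ) * (3 / 2 / T) < 1 := by
    have e : r * (3 * (z + 3) / T) = 3 * r * ((z + 5 / 2) / T) + r * (3 / 2 / T) := by
      field_simp; ring
    linarith
  have hLr : 1 + L ≤ r := by
    have := one_add_mul_self_le_rpow_one_add (s := 1) (by norm_num) (p := L) (by linarith)
    have h2L : (2 : ℝ) ^ L ≤ (1 / α) ^ L := Real.rpow_le_rpow (by norm_num) hb2 (by linarith)
    rw [hrL] at h2L
    norm_num at this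
    linarith
  have : (r : ℝ) * (3 / 2 / T) = (3 / 2 * r) / T := by ring
  rw [this, div_lt_one hT0] at hTr
  linarith

theorem card_le_of_isEquiangular {r : ℕ} {α : ℝ} (hα : 0 < α) (hα1 : α < 1)
    (hr : 1 / α ^ 4 ≤ (r : ℝ)) {C : Set (ℙ ℝ (EuclideanSpace ℝ (Fin r)))}
    (hC : IsEquiangular α C) (F : Finset (ℙ ℝ (EuclideanSpace ℝ (Fin r)))) (hF : ↑F ⊆ C) :
    (F.card : ℝ) ≤ r + r * excessBound α r := by
  have hpos : ∀ M : ℙ ℝ (EuclideanSpace ℝ (Fin r)), 0 < ‖M.rep‖ := fun M =>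
    norm_pos_iff.2 M.rep_nonzero
  have hin : ∀ M N : ℙ ℝ (EuclideanSpace ℝ (Fin r)),
      inner ℝ ((‖M.rep‖⁻¹) • M.rep) ((‖N.rep‖⁻¹) • N.rep) =
        Real.cos (InnerProductGeometry.angle M.rep N.rep) := fun M N => by
    rw [InnerProductGeometry.cos_angle, inner_smul_left, inner_smul_right, conj_trivial]
    field_simp
  have := card_le_of_inner (ι := F) hα hα1 hr (fun M => (‖M.1.rep‖⁻¹) • M.1.rep) ?_ ?_
  · simpa using this
  · intro M
    rw [hin, InnerProductGeometry.angle_self M.1.rep_nonzero, Real.cos_zero]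
  · intro M N hMN
    rw [hin]
    have h := hC M.1 (hF M.2) N.1 (hF N.2) fun e => hMN (Subtype.ext e)
    have hcos := Real.cos_arccos (by linarith : -1 ≤ α) hα1.le
    rw [← h, acuteAngle] at hcos
    rcases min_choice (InnerProductGeometry.angle M.1.rep N.1.rep)
      (Real.pi - InnerProductGeometry.angle M.1.rep N.1.rep) with e | e <;> rw [e] at hcos
    · left; exact hcos
    · right; rw [Real.cos_pi_sub] at hcos; linarith

theorem finite_and_ncard_le {r : ℕ} {α : ℝ} (hα : 0 < α) (hα1 : α < 1)
    (hr : 1 / α ^ 4 ≤ (r : ℝ)) {C : Set (ℙ ℝ (EuclideanSpace ℝ (Fin r)))}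
    (hC : IsEquiangular α C) :
    C.Finite ∧ (C.ncard : ℝ) ≤ r + r * excessBound α r := by
  have hfin : C.Finite := by
    by_contra hinf
    obtain ⟨F, hF, hcard⟩ := Set.Infinite.exists_subset_card_eq hinf
      (⌊(r : ℝ) + r * excessBound α r⌋₊ + 1)
    have h1 := card_le_of_isEquiangular hα hα1 hr hC F hF
    have h2 := Nat.lt_floor_add_one ((r : ℝ) + r * excessBound α r)
    rw [hcard] at h1
    push_cast at h1
    linarith
  refine ⟨hfin, ?_⟩
  rw [Set.ncard_eq_toFinset_card C hfin]
  exact card_le_of_isEquiangular hα hα1 hr hC _ (by simp)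

/-- There are always `r` equiangular lines in dimension `r`. -/
theorem le_maxEquiangular {r : ℕ} {α : ℝ} (hα : 0 < α) (hα1 : α < 1) (hr : 1 ≤ r) :
    (r : ℕ∞) ≤ maxEquiangular α r := by
  have hr0 : (0 : ℝ) < r := by exact_mod_cast hr
  obtain ⟨a, b, ha, hab⟩ : ∃ a b : ℝ, a ^ 2 = 1 - α ∧ r * b ^ 2 + 2 * a * b = α := by
    have h1 : √(1 - α) ^ 2 = 1 - α := Real.sq_sqrt (by linarith)
    have h2 : √(1 - α + r * α) ^ 2 = 1 - α + r * α := by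
      refine Real.sq_sqrt ?_
      have := mul_pos hr0 hα
      linarith
    refine ⟨√(1 - α), (√(1 - α + r * α) - √(1 - α)) / r, h1, ?_⟩
    field_simp
    linear_combination h2 - h1
  let w : Fin r → EuclideanSpace ℝ (Fin r) := fun i =>
    WithLp.toLp 2 fun k => (if k = i then a else 0) + b
  have hw : ∀ i j, inner ℝ (w i) (w j) = (if i = j then 1 - α else 0) + α := fun i j => by
    simp only [w, PiLp.inner_apply, RCLike.inner_apply, conj_trivial, add_mul, mul_add,
      Finset.sum_add_distrib, ite_mul, mul_ite, zero_mul, mul_zero, Finset.sum_ite_eq',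
      Finset.mem_univ, if_true, Finset.sum_const, Finset.card_univ, Fintype.card_fin,
      nsmul_eq_mul]
    split_ifs
    · linear_combination ha + hab
    · linear_combination hab
  have hn : ∀ i, ‖w i‖ = 1 := fun i => by
    have := hw i i
    rw [if_pos rfl, real_inner_self_eq_norm_sq] at this
    rw [← sq_eq_sq₀ (norm_nonneg _) zero_le_one]; linarith
  have hw0 : ∀ i, w i ≠ 0 := fun i => norm_pos_iff.1 (by rw [hn]; exact one_pos)
  have hα' : 0 < Real.arccos α := Real.arccos_pos.2 hα1
  have hangle : ∀ i j, i ≠ j → acuteAngle (Projectivization.mk ℝ (w i) (hw0 i))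
      (Projectivization.mk ℝ (w j) (hw0 j)) = Real.arccos α := fun i j hij => by
    rw [acuteAngle_mk, InnerProductGeometry.angle, hw, if_neg hij, hn, hn]
    simp only [zero_add, mul_one, div_one]
    refine min_eq_left ?_
    have := Real.arccos_le_pi_div_two.2 hα.le
    linarith
  have hinj : Function.Injective fun i => Projectivization.mk ℝ (w i) (hw0 i) := fun i j hij => by
    by_contra hne
    have h1 := hangle i j hne
    have h2 : acuteAngle (Projectivization.mk ℝ (w i) (hw0 i))
        (Projectivization.mk ℝ (w i) (hw0 i)) = 0 := by
      rw [acuteAngle_mk, InnerProductGeometry.angle_self (hw0 i), sub_zero]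
      exact min_eq_left Real.pi_pos.le
    have hij' : Projectivization.mk ℝ (w i) (hw0 i) = Projectivization.mk ℝ (w j) (hw0 j) := hij
    rw [← hij', h2] at h1
    exact hα'.ne h1
  have hcard : (Set.range fun i => Projectivization.mk ℝ (w i) (hw0 i)).encard = r := by
    rw [← Set.image_univ, hinj.encard_image, Set.encard_univ]
    simp
  rw [← hcard]
  refine le_iSup₂_of_le (f := fun C _ => C.encard)
    (Set.range fun i => Projectivization.mk ℝ (w i) (hw0 i)) ?_ le_rfl
  rintro _ ⟨i, rfl⟩ _ ⟨j, rfl⟩ hne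
  exact hangle i j fun e => hne (by rw [e])

theorem maxEquiangular_bounds {r : ℕ} {α : ℝ} (hα : 0 < α) (hα1 : α < 1)
    (hr : 1 / α ^ 4 ≤ (r : ℝ)) :
    ∃ N : ℕ, maxEquiangular α r = N ∧ (r : ℝ) ≤ N ∧ (N : ℝ) ≤ r + r * excessBound α r := by
  have hr0 : (0 : ℝ) < r := lt_of_lt_of_le (by positivity) hr
  have hle : maxEquiangular α r ≤ (⌊(r : ℝ) + r * excessBound α r⌋₊ : ℕ) := by
    refine iSup₂_le fun C hC => ?_
    obtain ⟨hfin, hcard⟩ := finite_and_ncard_le hα hα1 hr hC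
    rw [← hfin.cast_ncard_eq]
    exact_mod_cast Nat.le_floor hcard
  obtain ⟨N, hN⟩ := ENat.ne_top_iff_exists.1 (ne_top_of_le_ne_top (ENat.natCast_ne_top _) hle)
  refine ⟨N, hN.symm, ?_, ?_⟩
  · have := le_maxEquiangular hα hα1 (r := r) (by exact_mod_cast hr0)
    rw [← hN] at this
    exact_mod_cast this
  · rw [← hN] at hle
    have h1 : N ≤ ⌊(r : ℝ) + r * excessBound α r⌋₊ := by exact_mod_cast hle
    have h2 : 0 ≤ (r : ℝ) + r * excessBound α r :=
      add_nonneg hr0.le (mul_nonneg hr0.le (excessBound_nonneg hα hα1 r))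
    exact (Nat.cast_le.2 h1).trans (Nat.floor_le h2)

theorem tendsto_excessBound {ι : Type*} {l : Filter ι} {α r : ι → ℝ}
    (hpos : ∀ᶠ i in l, 0 < α i) (hα : Filter.Tendsto α l (nhds 0))
    (hL : Filter.Tendsto (fun i => Real.logb (1 / α i) (r i)) l Filter.atTop) :
    Filter.Tendsto (fun i => excessBound (α i) (r i)) l (nhds 0) := by
  have h1 : Filter.Tendsto (fun x : ℝ => 66 * (Real.logb 2 x) ^ 2 / x) Filter.atTop (nhds 0) := by
    have h := (Real.isLittleO_pow_log_id_atTop (n := 2)).tendsto_div_nhds_zero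
    have h' := h.const_mul (66 / (Real.log 2) ^ 2)
    rw [mul_zero] at h'
    refine h'.congr fun x => ?_
    simp only [Real.logb, id]
    ring
  have h2 : Filter.Tendsto (fun i => 17 * α i * Real.logb 2 (2 / α i)) l (nhds 0) := by
    have hc : Continuous fun x : ℝ => 17 / Real.log 2 * (x * Real.log 2 - x * Real.log x) :=
      continuous_const.mul ((continuous_id.mul continuous_const).sub Real.continuous_mul_log)
    have h := (hc.tendsto 0).comp hα
    simp only [zero_mul, sub_zero, mul_zero] at h
    refine h.congr' ?_
    filter_upwards [hpos] with i hi
    simp only [Function.comp, Real.logb]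
    rw [Real.log_div (by norm_num) hi.ne']
    ring
  have := (h1.comp hL).max h2
  rwa [max_self] at this

theorem theorem3p5 :
    (∀ (α : ℝ) (r : ℕ), 0 < α → α < 1 → 1 / α ^ 4 ≤ (r : ℝ) →
      ∀ C : Set (ℙ ℝ (EuclideanSpace ℝ (Fin r))), IsEquiangular α C →
        C.Finite ∧
        (C.ncard : ℝ) ≤ r + r * max
          (66 * (Real.logb 2 (Real.logb (1 / α) r)) ^ 2 / Real.logb (1 / α) r)
          (17 * α * Real.logb 2 (2 / α))) ∧
    (∀ {ι : Type*} (l : Filter ι) (α : ι → ℝ) (r : ι → ℕ) (ω : ι → ℝ),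
      (∀ᶠ i in l, 0 < α i) →
      Filter.Tendsto α l (nhds 0) →
      Filter.Tendsto ω l Filter.atTop →
      (∀ᶠ i in l, (1 / α i) ^ ω i ≤ (r i : ℝ)) →
      ∃ N : ι → ℕ,
        (∀ᶠ i in l, maxEquiangular (α i) (r i) = (N i : ℕ∞)) ∧
        (fun i => (N i : ℝ) - (r i : ℝ)) =o[l] (fun i => (r i : ℝ))) := by
  refine ⟨fun α r hα hα1 hr C hC => finite_and_ncard_le hα hα1 hr hC, ?_⟩
  intro ι l α r ω hpos hα hω hr
  have hα1 : ∀ᶠ i in l, α i < 1 := hα.eventually_lt_const one_pos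
  have hω4 : ∀ᶠ i in l, 4 ≤ ω i := hω.eventually_ge_atTop 4
  have hL : Filter.Tendsto (fun i => Real.logb (1 / α i) (r i)) l Filter.atTop := by
    refine Filter.tendsto_atTop_mono' l ?_ hω
    filter_upwards [hpos, hα1, hr] with i h0 h1 hri
    have hb : 1 < 1 / α i := by rw [lt_div_iff₀ h0]; linarith
    exact (Real.le_logb_iff_rpow_le hb (lt_of_lt_of_le (by positivity) hri)).2 hri
  have hbounds : ∀ᶠ i in l, ∃ N : ℕ, maxEquiangular (α i) (r i) = N ∧ (r i : ℝ) ≤ N ∧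
      (N : ℝ) ≤ r i + r i * excessBound (α i) (r i) := by
    filter_upwards [hpos, hα1, hr, hω4] with i h0 h1 hri h4
    refine maxEquiangular_bounds h0 h1 (le_trans ?_ hri)
    have hb : 1 ≤ 1 / α i := by rw [le_div_iff₀ h0]; linarith
    have := Real.rpow_le_rpow_of_exponent_le hb h4
    rwa [show (4 : ℝ) = ((4 : ℕ) : ℝ) by norm_num, Real.rpow_natCast, one_div_pow] at this
  refine ⟨fun i => (maxEquiangular (α i) (r i)).toNat, ?_, ?_⟩
  · filter_upwards [hbounds] with i ⟨N, hN, _⟩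
    rw [hN, ENat.toNat_natCast]
  · rw [Asymptotics.isLittleO_iff]
    intro c hc
    filter_upwards [hbounds, (tendsto_excessBound hpos hα hL).eventually_lt_const hc] with
      i ⟨N, hN, hlow, hup⟩ hlt
    rw [hN, ENat.toNat_natCast, Real.norm_of_nonneg (by linarith), Real.norm_of_nonneg (by positivity)]
    have := mul_le_mul_of_nonneg_left hlt.le (Nat.cast_nonneg (α := ℝ) (r i))
    linarith
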